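/- Let $\tfrac12<\mu\le 1$, $0<\epsilon<\tfrac12$, $p:=\frac{1-\mu}{\mu}$, and let $I\subset\mathbb R$ be bounded (e.g. $I=[-a,a]$). **Spin blocks.** For $j\in\{0,\tfrac12,1,\dots\}$ let $\mathcal H_j\cong\mathbb C^{2j+1}$ be the spin-$j$ irreducible representation $\pi_j$ of $SU(2)$ with orthonormal basis $|j,m\rangle$, $m=-j,\dots,j$, on which the angular momentum operators act by $J_z|j,m\rangle=m|j,m\rangle$ and $(J_x\pm iJ_y)|j,m\rangle=\sqrt{(j\mp m)(j\pm m+1)}\,|j,m\pm1\rangle$. For $\mathbf u=(u_x,u_y)\in\mathbb R^2$ let $U(\mathbf u)=\exp(i(u_x\sigma_x+u_y\sigma_y))$ and let $U_j(\mathbf u)=\pi_j(U(\mathbf u))=\exp(2i(u_xJ_x+u_yJ_y))$. Put $$\rho^{\mathbf 0}_{j,n}=\frac{1-p}{1-p^{2j+1}}\sum_{m=-j}^{j}p^{\,j-m}|j,m\rangle\langle j,m|,\qquad \rho^{\mathbf u}_{j,n}=U_j\!\left(\tfrac{\mathbf u}{\sqrt n}\right)\rho^{\mathbf 0}_{j,n}\,U_j\!\left(\tfrac{\mathbf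 u}{\sqrt n}\right)^{*}.$$ These are the normalized spin-$j$ blocks of the $n$-qubit state $\left[U(\mathbf u/\sqrt n)\,\mathrm{diag}(\mu,1-\mu)\,U(\mathbf u/\sqrt n)^*\right]^{\otimes n}$. Let $\mathcal J_{n,\epsilon}$ be the set of $j\in\{\tfrac n2,\tfrac n2-1,\dots\}$, $j\ge0$, with $|j-n(\mu-\tfrac12)|\le n^{1/2+\epsilon}$. **Oscillator.** Let $\mathcal H$ be the Hilbert space of a quantum harmonic oscillator with orthonormal basis of energy levels $|k\rangle$, $k\ge0$, and $a^*|k\rangle=\sqrt{k+1}\,|k+1\rangle$, $a|k\rangle=\sqrt k\,|k-1\rangle$. Let $D(z)=\exp(za^*-\bar za)$ for $z\in\mathbb C$, and $$\phi^{\mathbf 0}=(1-p)\sum_{k\ge0}p^k|k\rangle\langle k|,\qquad \phi^{\mathbf u}=D\big(\sqrt{2\mu-1}\,\alpha_{\mathbf u}\big)\,\phi^{\mathbf 0}\,D\big(\sqrt{2\mu-1}\,\alpha_{\mathbf u}\big)^{*},\qquad \alpha_{\mathbf u}=-u_y+iu_x .$$ Let $V_j:\mathcal H_j\to\mathcal H$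 be the isometry $|j,m\rangle\mapsto|j-m\rangle$, and let $\|T\|_1=\mathrm{Tr}\,|T|$ be the trace norm. **Proposition.** $$\lim_{n\to\infty}\ \sup_{\mathbf u\in I^2}\ \max_{j\in\mathcal J_{n,\epsilon}}\ \big\|V_j\,\rho^{\mathbf u}_{j,n}\,V_j^*-\phi^{\mathbf u}\big\|_1=0 .$$ -/

import Mathlib

open Filter Topology
open scoped ENNReal Matrix ComplexConjugate

namespace QubitLAN

noncomputable section

/-! ### Qubits -/

def pauliX : Matrix (Fin 2) (Fin 2) ℂ := !![0, 1; 1, 0]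

def pauliY : Matrix (Fin 2) (Fin 2) ℂ := !![0, -Complex.I; Complex.I, 0]

def pauliZ : Matrix (Fin 2) (Fin 2) ℂ := !![1, 0; 0, -1]

/-- `exp (i (t₁ σ_x + t₂ σ_y + t₃ σ_z))`; every element of `SU(2)` is of this form. -/
def qubitExp (t₁ t₂ t₃ : ℝ) : Matrix (Fin 2) (Fin 2) ℂ :=
  NormedSpace.exp
    (Complex.I • ((t₁ : ℂ) • pauliX + (t₂ : ℂ) • pauliY + (t₃ : ℂ) • pauliZ))

/-- The rotated qubit state `U(u) diag(μ, 1 - μ) U(u)^*`,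
where `U(u) = exp (i (u_x σ_x + u_y σ_y))`. -/
def qubitState (μ : ℝ) (u : ℝ × ℝ) : Matrix (Fin 2) (Fin 2) ℂ :=
  qubitExp u.1 u.2 0 * Matrix.diagonal ![(μ : ℂ), 1 - (μ : ℂ)] * (qubitExp u.1 u.2 0)ᴴ

/-- `A^{⊗ n}` in the product basis of `(ℂ²)^{⊗ n}`, which is indexed by `Fin n → Fin 2`. -/
def tensorPower (n : ℕ) (A : Matrix (Fin 2) (Fin 2) ℂ) :
    Matrix (Fin n → Fin 2) (Fin n → Fin 2) ℂ :=
  Matrix.of fun x y => ∏ i, A (x i) (y i)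

/-- The local parameter `u / √n`. -/
def localParam (n : ℕ) (u : ℝ × ℝ) : ℝ × ℝ := (u.1 / √(n : ℝ), u.2 / √(n : ℝ))

/-- The joint state `ρ^u_n` of `n` qubits. -/
def jointState (μ : ℝ) (n : ℕ) (u : ℝ × ℝ) : Matrix (Fin n → Fin 2) (Fin n → Fin 2) ℂ :=
  tensorPower n (qubitState μ (localParam n u))

/-! ### The spin-`j` representation

A spin `j ∈ {0, 1/2, 1, …}` is represented by the natural number `d = 2 j`. The space `H_j` is
`ℂ^{d+1}`, and the index `k : Fin (d + 1)` stands for the basis vector `|j, m⟩` with `m = j - k`. -/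

/-- `J_z |j,m⟩ = m |j,m⟩`. -/
def spinZ (d : ℕ) : Matrix (Fin (d + 1)) (Fin (d + 1)) ℂ :=
  Matrix.diagonal fun k => (d : ℂ) / 2 - (k : ℕ)

/-- `J_+ |j,m⟩ = √(j - m) √(j + m + 1) |j,m+1⟩`. -/
def spinRaise (d : ℕ) : Matrix (Fin (d + 1)) (Fin (d + 1)) ℂ :=
  Matrix.of fun l k =>
    if (l : ℕ) + 1 = k then ((√((k : ℕ) : ℝ) * √((d : ℝ) - (k : ℕ) + 1) : ℝ) : ℂ) else 0

/-- `J_- |j,m⟩ = √(j - m + 1) √(j + m) |j,m-1⟩`. -/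
def spinLower (d : ℕ) : Matrix (Fin (d + 1)) (Fin (d + 1)) ℂ :=
  Matrix.of fun l k =>
    if (l : ℕ) = k + 1 then ((√(((k : ℕ) : ℝ) + 1) * √((d : ℝ) - (k : ℕ)) : ℝ) : ℂ) else 0

/-- `J_x`, from `J_± = J_x ± i J_y`. -/
def spinX (d : ℕ) : Matrix (Fin (d + 1)) (Fin (d + 1)) ℂ :=
  (1 / 2 : ℂ) • (spinRaise d + spinLower d)

/-- `J_y`, from `J_± = J_x ± i J_y`. -/
def spinY (d : ℕ) : Matrix (Fin (d + 1)) (Fin (d + 1)) ℂ :=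
  (1 / (2 * Complex.I) : ℂ) • (spinRaise d - spinLower d)

/-- The image of `qubitExp t₁ t₂ t₃` in the spin-`j` representation of `SU(2)`:
the Pauli matrix `σ_l` acts as `2 J_l`. -/
def spinExp (d : ℕ) (t₁ t₂ t₃ : ℝ) : Matrix (Fin (d + 1)) (Fin (d + 1)) ℂ :=
  NormedSpace.exp
    (Complex.I • ((t₁ : ℂ) • ((2 : ℂ) • spinX d) + (t₂ : ℂ) • ((2 : ℂ) • spinY d)
      + (t₃ : ℂ) • ((2 : ℂ) • spinZ d)))

/-- `p = (1 - μ) / μ`. -/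
def thermalRatio (μ : ℝ) : ℝ := (1 - μ) / μ

/-- `ρ^0_{j,n} = c_j(p) ∑_m p^{j-m} |j,m⟩⟨j,m|` with `c_j(p) = (1 - p) / (1 - p^{2j+1})`. -/
def blockStateZero (μ : ℝ) (d : ℕ) : Matrix (Fin (d + 1)) (Fin (d + 1)) ℂ :=
  Matrix.diagonal fun k =>
    (((1 - thermalRatio μ) / (1 - thermalRatio μ ^ (d + 1)) * thermalRatio μ ^ (k : ℕ) : ℝ) : ℂ)

/-- The block state `ρ^u_{j,n} = U_j(u/√n) ρ^0_{j,n} U_j(u/√n)^*` with `j = d / 2`.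
See `jointState_block` for the fact that this is the block of `ρ^u_n`. -/
def blockState (μ : ℝ) (n d : ℕ) (u : ℝ × ℝ) : Matrix (Fin (d + 1)) (Fin (d + 1)) ℂ :=
  spinExp d (localParam n u).1 (localParam n u).2 0 * blockStateZero μ d *
    (spinExp d (localParam n u).1 (localParam n u).2 0)ᴴ

/-- `W` is an isometric embedding of the spin-`d/2` representation of `SU(2)` into
`(ℂ²)^{⊗ n}` that intertwines the actions of `SU(2)`. -/
structure IsSpinCopy (n d : ℕ) (W : Matrix (Fin n → Fin 2) (Fin (d + 1)) ℂ) : Prop where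
  isometry : Wᴴ * W = 1
  intertwines : ∀ t₁ t₂ t₃ : ℝ, tensorPower n (qubitExp t₁ t₂ t₃) * W = W * spinExp d t₁ t₂ t₃

/-- The values `j = d / 2` of the total angular momentum of `n` qubits (that is,
`j ∈ {n/2, n/2 - 1, …}`, `j ≥ 0`) that lie in
`[n (μ - 1/2) - n^{1/2+ε}, n (μ - 1/2) + n^{1/2+ε}]`. -/
def typicalSpins (μ ε : ℝ) (n : ℕ) : Set ℕ :=
  {d | (∃ r : ℕ, n = d + 2 * r) ∧
    |(d : ℝ) / 2 - (n : ℝ) * (μ - 1 / 2)| ≤ (n : ℝ) ^ (1 / 2 + ε)}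

/-! ### The block decomposition of the joint state -/

lemma tensorPower_mul (n : ℕ) (A B : Matrix (Fin 2) (Fin 2) ℂ) :
    tensorPower n (A * B) = tensorPower n A * tensorPower n B := by
  ext x y
  simp only [tensorPower, Matrix.of_apply, Matrix.mul_apply, ← Finset.prod_mul_distrib]
  rw [Finset.prod_univ_sum]
  simp

lemma tensorPower_conjTranspose (n : ℕ) (A : Matrix (Fin 2) (Fin 2) ℂ) :
    tensorPower n Aᴴ = (tensorPower n A)ᴴ := by
  ext x y
  simp [tensorPower, Matrix.conjTranspose_apply]

lemma tensorPower_diagonal (n : ℕ) (a : Fin 2 → ℂ) :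
    tensorPower n (Matrix.diagonal a) = Matrix.diagonal fun x => ∏ i, a (x i) := by
  ext x y
  rw [tensorPower, Matrix.of_apply]
  by_cases h : x = y
  · subst h; simp
  · rw [Matrix.diagonal_apply_ne _ h]
    obtain ⟨i, hi⟩ := Function.ne_iff.1 h
    exact Finset.prod_eq_zero (Finset.mem_univ i) (Matrix.diagonal_apply_ne _ hi)

lemma qubitExp_z (t : ℝ) :
    qubitExp 0 0 t = Matrix.diagonal
      ![Complex.exp (Complex.I * t), Complex.exp (-(Complex.I * t))] := by
  have : Complex.I • (((0 : ℝ) : ℂ) • pauliX + ((0 : ℝ) : ℂ) • pauliY + (t : ℂ) • pauliZ)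
      = Matrix.diagonal ![Complex.I * t, -(Complex.I * t)] := by
    ext i j; fin_cases i <;> fin_cases j <;> simp [pauliZ]
  rw [qubitExp, this, Matrix.exp_diagonal]
  congr 1
  ext i
  rw [Pi.coe_exp]
  fin_cases i <;> simp [Complex.exp_eq_exp_ℂ]

lemma spinExp_z (d : ℕ) (t : ℝ) :
    spinExp d 0 0 t = Matrix.diagonal fun k : Fin (d + 1) =>
      Complex.exp (Complex.I * t * ((d : ℂ) - 2 * (k : ℕ))) := by
  have : Complex.I • (((0 : ℝ) : ℂ) • ((2 : ℂ) • spinX d) + ((0 : ℝ) : ℂ) • ((2 : ℂ) • spinY d)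
      + (t : ℂ) • ((2 : ℂ) • spinZ d))
      = Matrix.diagonal fun k : Fin (d + 1) => Complex.I * t * ((d : ℂ) - 2 * (k : ℕ)) := by
    ext i j
    by_cases h : i = j
    · subst h; simp [spinZ]; ring
    · simp [spinZ, h]
  rw [spinExp, this, Matrix.exp_diagonal]
  congr 1
  ext i
  rw [Pi.coe_exp]
  simp [Complex.exp_eq_exp_ℂ]

/-- The number of down spins. -/
def downCount {n : ℕ} (x : Fin n → Fin 2) : ℕ := (Finset.univ.filter fun i => x i = 1).card

lemma downCount_le {n : ℕ} (x : Fin n → Fin 2) : downCount x ≤ n := by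
  simpa [downCount] using Finset.card_filter_le (Finset.univ : Finset (Fin n)) fun i => x i = 1

lemma prod_two {n : ℕ} (a : Fin 2 → ℂ) (x : Fin n → Fin 2) :
    ∏ i, a (x i) = a 0 ^ (n - downCount x) * a 1 ^ downCount x := by
  have h : ∀ i, a (x i) = if x i = 1 then a 1 else a 0 := by
    intro i
    rcases Fin.exists_fin_two.1 ⟨x i, rfl⟩ with h | h <;> simp [h]
  have hc := Finset.card_filter_add_card_filter_not (s := (Finset.univ : Finset (Fin n)))
    (fun i => x i = 1)
  rw [Finset.prod_congr rfl fun i _ => h i, Finset.prod_ite, Finset.prod_const,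
    Finset.prod_const, mul_comm]
  have : (Finset.univ.filter fun i => ¬ x i = 1).card = n - downCount x := by
    simp only [Finset.card_univ, Fintype.card_fin] at hc
    unfold downCount; omega
  rw [this]; rfl

/-- A copy of the spin-`d/2` representation respects the weights of `J_z`. -/
lemma IsSpinCopy.weight {n d : ℕ} {W : Matrix (Fin n → Fin 2) (Fin (d + 1)) ℂ}
    (hW : IsSpinCopy n d W) (x : Fin n → Fin 2) (k : Fin (d + 1)) (hx : W x k ≠ 0) :
    (n : ℤ) - 2 * downCount x = (d : ℤ) - 2 * (k : ℕ) := by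
  by_contra hne
  set q : ℤ := ((n : ℤ) - 2 * downCount x) - ((d : ℤ) - 2 * (k : ℕ)) with hq
  have hq0 : (q : ℂ) ≠ 0 := by
    have : q ≠ 0 := by omega
    exact_mod_cast this
  have h := congrFun (congrFun (hW.intertwines 0 0 (Real.pi / q)) x) k
  rw [qubitExp_z, tensorPower_diagonal, spinExp_z, Matrix.diagonal_mul, Matrix.mul_diagonal,
    prod_two, mul_comm] at h
  have h2 := mul_left_cancel₀ hx h
  simp only [Matrix.cons_val_zero, Matrix.cons_val_one, ← Complex.exp_nat_mul,
    ← Complex.exp_add] at h2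
  have h3 : Complex.exp (Real.pi * Complex.I) = 1 := by
    rw [← sub_eq_zero, sub_eq_zero, ← div_self (Complex.exp_ne_zero
      (Complex.I * ((Real.pi / q : ℝ) : ℂ) * ((d : ℂ) - 2 * (k : ℕ))))]
    nth_rewrite 1 [← h2]
    rw [← Complex.exp_sub]
    congr 1
    rw [Nat.cast_sub (downCount_le x)]
    have hqc : (q : ℂ) = ((n : ℂ) - 2 * downCount x) - ((d : ℂ) - 2 * (k : ℕ)) := by
      rw [hq]; push_cast; ring
    push_cast
    have : (Real.pi : ℂ) * Complex.I = Complex.I * (Real.pi / q) * q := by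
      field_simp
    rw [this]
    nth_rewrite 2 [hqc]
    ring
  rw [Complex.exp_pi_mul_I] at h3
  norm_num at h3

/-- On every copy of the spin-`j` representation, `j = d / 2 = n / 2 - r`, the joint state
`ρ^u_n` acts as `(p_n(j) / n_j) ρ^u_{j,n}`, where
`p_n(j) / n_j = (1-μ)^{n/2-j} μ^{n/2+j+1} (1 - p^{2j+1}) / (2μ-1)`. -/
theorem jointState_block {μ : ℝ} (hμ : 1 / 2 < μ) (hμ1 : μ ≤ 1) {n d r : ℕ}
    (hn : n = d + 2 * r) {W : Matrix (Fin n → Fin 2) (Fin (d + 1)) ℂ} (hW : IsSpinCopy n d W)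
    (u : ℝ × ℝ) :
    Wᴴ * jointState μ n u * W =
      (((1 - μ) ^ r * μ ^ (d + r + 1) * (1 - thermalRatio μ ^ (d + 1)) / (2 * μ - 1) : ℝ) : ℂ) •
        blockState μ n d u := by
  set w : ℝ := (1 - μ) ^ r * μ ^ (d + r + 1) * (1 - thermalRatio μ ^ (d + 1)) / (2 * μ - 1)
    with hw
  set v := localParam n u
  have hμ0 : μ ≠ 0 := by linarith
  have hp1 : thermalRatio μ < 1 := by
    rw [thermalRatio, div_lt_one (by linarith)]; linarith
  have hp0 : 0 ≤ thermalRatio μ := div_nonneg (by linarith) (by linarith)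
  have hpd : 1 - thermalRatio μ ^ (d + 1) ≠ 0 := by
    have := pow_lt_one₀ hp0 hp1 (Nat.succ_ne_zero d)
    rw [Nat.succ_eq_add_one] at this
    exact (sub_pos.2 this).ne'
  have hZ : tensorPower n (Matrix.diagonal ![(μ : ℂ), 1 - (μ : ℂ)]) * W =
      W * ((w : ℂ) • blockStateZero μ d) := by
    ext x k
    rw [tensorPower_diagonal, Matrix.diagonal_mul, blockStateZero, Matrix.mul_smul,
      Matrix.smul_apply, Matrix.mul_diagonal, prod_two]
    by_cases hx : W x k = 0
    · simp [hx]
    have hwt := hW.weight x k hx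
    have hk := k.isLt
    have h1 : downCount x = r + k := by omega
    have h2 : n - downCount x = r + (d - k) := by omega
    have key : μ ^ (r + (d - k)) * (1 - μ) ^ (r + (k : ℕ)) =
        w * ((1 - thermalRatio μ) / (1 - thermalRatio μ ^ (d + 1)) *
          thermalRatio μ ^ (k : ℕ)) := by
      have h2μ : 2 * μ - 1 ≠ 0 := by linarith
      have hq : 1 - thermalRatio μ = (2 * μ - 1) / μ := by
        rw [thermalRatio]; field_simp; ring
      have hd : μ ^ (d + r + 1) = μ ^ (r + (d - k)) * μ ^ (k : ℕ) * μ := by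
        rw [← pow_add, ← pow_succ]; congr 1; omega
      have hpk : thermalRatio μ ^ (k : ℕ) = (1 - μ) ^ (k : ℕ) / μ ^ (k : ℕ) := by
        rw [thermalRatio, div_pow]
      have hμk : μ ^ (k : ℕ) ≠ 0 := pow_ne_zero _ hμ0
      rw [hw, hd, hq, hpk, pow_add (1 - μ)]
      generalize 2 * μ - 1 = a at h2μ
      field_simp
    rw [h2, h1, smul_eq_mul, mul_left_comm, ← Complex.ofReal_mul, ← key]
    simp only [Matrix.cons_val_zero, Matrix.cons_val_one]
    push_cast
    ring
  have hU := hW.intertwines v.1 v.2 0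
  have hEqv : Wᴴ * tensorPower n (qubitExp v.1 v.2 0) = spinExp d v.1 v.2 0 * Wᴴ := by
    have hstar : (qubitExp (-v.1) (-v.2) 0)ᴴ = qubitExp v.1 v.2 0 := by
      rw [qubitExp, qubitExp, ← Matrix.exp_conjTranspose]
      congr 1
      ext i j
      fin_cases i <;> fin_cases j <;> simp [pauliX, pauliY, pauliZ] <;> ring
    have hstar' : (spinExp d (-v.1) (-v.2) 0)ᴴ = spinExp d v.1 v.2 0 := by
      rw [spinExp, spinExp, ← Matrix.exp_conjTranspose]
      congr 1
      have hR : (spinRaise d)ᴴ = spinLower d := by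
        ext i j
        by_cases h : (i : ℕ) = j + 1
        · rw [Matrix.conjTranspose_apply]
          simp only [spinRaise, spinLower, Matrix.of_apply, h, if_true]
          push_cast
          rw [show (d : ℝ) - ((j : ℕ) + 1) + 1 = d - (j : ℕ) by ring]
          simp
        · rw [Matrix.conjTranspose_apply]
          simp only [spinRaise, spinLower, Matrix.of_apply, h, Ne.symm h, if_false]
          simp
      have hL : (spinLower d)ᴴ = spinRaise d := by
        rw [← hR, Matrix.conjTranspose_conjTranspose]
      have hX : (spinX d)ᴴ = spinX d := by
        rw [spinX, Matrix.conjTranspose_smul, Matrix.conjTranspose_add, hR, hL, add_comm (spinLower d)]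
        simp
      have hY : (spinY d)ᴴ = spinY d := by
        rw [spinY, Matrix.conjTranspose_smul, Matrix.conjTranspose_sub, hR, hL,
          ← neg_sub (spinRaise d), smul_neg, ← neg_smul]
        congr 1
        simp
      simp [Matrix.conjTranspose_smul, hX, hY]
    have h := congrArg Matrix.conjTranspose (hW.intertwines (-v.1) (-v.2) 0)
    rwa [Matrix.conjTranspose_mul, Matrix.conjTranspose_mul, ← tensorPower_conjTranspose,
      hstar, hstar'] at h
  have hEqv' : (tensorPower n (qubitExp v.1 v.2 0))ᴴ * W = W * (spinExp d v.1 v.2 0)ᴴ := by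
    have := congrArg Matrix.conjTranspose hEqv
    simpa [Matrix.conjTranspose_mul] using this
  rw [jointState, qubitState, tensorPower_mul, tensorPower_mul, tensorPower_conjTranspose]
  calc Wᴴ * (tensorPower n (qubitExp v.1 v.2 0) *
          tensorPower n (Matrix.diagonal ![(μ : ℂ), 1 - (μ : ℂ)]) *
          (tensorPower n (qubitExp v.1 v.2 0))ᴴ) * W
      = (Wᴴ * tensorPower n (qubitExp v.1 v.2 0)) *
          tensorPower n (Matrix.diagonal ![(μ : ℂ), 1 - (μ : ℂ)]) *
          ((tensorPower n (qubitExp v.1 v.2 0))ᴴ * W) := by simp only [Matrix.mul_assoc]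
    _ = spinExp d v.1 v.2 0 * Wᴴ *
          (tensorPower n (Matrix.diagonal ![(μ : ℂ), 1 - (μ : ℂ)]) * W) *
          (spinExp d v.1 v.2 0)ᴴ := by rw [hEqv, hEqv']; simp only [Matrix.mul_assoc]
    _ = spinExp d v.1 v.2 0 * (Wᴴ * W) * ((w : ℂ) • blockStateZero μ d) *
          (spinExp d v.1 v.2 0)ᴴ := by rw [hZ]; simp only [Matrix.mul_assoc]
    _ = (w : ℂ) • blockState μ n d u := by
      rw [hW.isometry, mul_one, Matrix.mul_smul, Matrix.smul_mul, blockState]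

/-! ### The quantum oscillator

The oscillator lives on a complex Hilbert space `H` with an orthonormal basis `b`, where
`b k = |k⟩` is the `k`-th energy level. Finite combinations of energy levels are represented by
their coefficients in `ℕ →₀ ℂ`. -/

/-- `a^* |k⟩ = √(k + 1) |k + 1⟩`. -/
def creation : (ℕ →₀ ℂ) →ₗ[ℂ] (ℕ →₀ ℂ) :=
  Finsupp.linearCombination ℂ fun k => Finsupp.single (k + 1) ((√((k : ℝ) + 1) : ℝ) : ℂ)

/-- `a |k⟩ = √k |k - 1⟩`, and `a |0⟩ = 0`. -/
def annihilation : (ℕ →₀ ℂ) →ₗ[ℂ] (ℕ →₀ ℂ) :=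
  Finsupp.linearCombination ℂ fun k => Finsupp.single (k - 1) ((√(k : ℝ) : ℝ) : ℂ)

/-- `z a^* - z̄ a`. -/
def displacementExponent (z : ℂ) : (ℕ →₀ ℂ) →ₗ[ℂ] (ℕ →₀ ℂ) :=
  z • creation - conj z • annihilation

lemma displacementExponent_single (z : ℂ) (k : ℕ) :
    displacementExponent z (Finsupp.single k 1) =
      (z * (√((k : ℝ) + 1) : ℝ)) • Finsupp.single (k + 1) 1
        - (conj z * (√(k : ℝ) : ℝ)) • Finsupp.single (k - 1) 1 := by
  simp [displacementExponent, creation, annihilation]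

section Oscillator

variable {H : Type*} [NormedAddCommGroup H] [InnerProductSpace ℂ H]

/-- The vector of `H` with the given coefficients. -/
def fockVector (b : HilbertBasis ℕ ℂ H) : (ℕ →₀ ℂ) →ₗ[ℂ] H :=
  Finsupp.linearCombination ℂ b

/-- The `N`-th term `(z a^* - z̄ a)^N |k⟩ / N!` of the series of `exp (z a^* - z̄ a) |k⟩`. -/
def displacementTerm (b : HilbertBasis ℕ ℂ H) (z : ℂ) (k N : ℕ) : H :=
  ((N.factorial : ℂ)⁻¹) • fockVector b ((displacementExponent z ^ N) (Finsupp.single k 1))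

/-- `exp (z a^* - z̄ a) |k⟩`. -/
def displacedLevel (b : HilbertBasis ℕ ℂ H) (z : ℂ) (k : ℕ) : H :=
  ∑' N, displacementTerm b z k N

lemma norm_fockVector_pow_le (b : HilbertBasis ℕ ℂ H) (z : ℂ) (N k : ℕ) :
    ‖fockVector b ((displacementExponent z ^ N) (Finsupp.single k 1))‖ ≤
      (2 * ‖z‖) ^ N * ∏ i ∈ Finset.range N, √((k : ℝ) + 1 + i) := by
  induction N generalizing k with
  | zero => simp [fockVector, b.orthonormal.1 k]
  | succ N ih =>
    rw [pow_succ, Module.End.mul_apply, displacementExponent_single, map_sub, map_sub, map_smul,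
      map_smul, map_smul, map_smul]
    refine (norm_sub_le _ _).trans ?_
    rw [norm_smul, norm_smul]
    have hP : ∏ i ∈ Finset.range (N + 1), √((k : ℝ) + 1 + i) =
        √((k : ℝ) + 1) * ∏ i ∈ Finset.range N, √(((k + 1 : ℕ) : ℝ) + 1 + i) := by
      rw [Finset.prod_range_succ', mul_comm]
      congr 1
      · simp
      · refine Finset.prod_congr rfl fun i _ => ?_
        congr 1; push_cast; ring
    have h1 := ih (k + 1)
    have h2 := ih (k - 1)
    have hmono : ∏ i ∈ Finset.range N, √(((k - 1 : ℕ) : ℝ) + 1 + i) ≤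
        ∏ i ∈ Finset.range N, √(((k + 1 : ℕ) : ℝ) + 1 + i) := by
      refine Finset.prod_le_prod (fun i _ => Real.sqrt_nonneg _) fun i _ => ?_
      apply Real.sqrt_le_sqrt
      have : ((k - 1 : ℕ) : ℝ) ≤ ((k + 1 : ℕ) : ℝ) := by exact_mod_cast (by omega)
      linarith
    have n1 : ‖z * ((√((k : ℝ) + 1) : ℝ) : ℂ)‖ = ‖z‖ * √((k : ℝ) + 1) := by
      rw [norm_mul, Complex.norm_real, Real.norm_of_nonneg (Real.sqrt_nonneg _)]
    have n2 : ‖conj z * ((√(k : ℝ) : ℝ) : ℂ)‖ ≤ ‖z‖ * √((k : ℝ) + 1) := by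
      rw [norm_mul, Complex.norm_real, Real.norm_of_nonneg (Real.sqrt_nonneg _), RCLike.norm_conj]
      gcongr
      linarith
    rw [hP, n1]
    have h2' := h2.trans (mul_le_mul_of_nonneg_left hmono (by positivity))
    calc _ ≤ ‖z‖ * √((k : ℝ) + 1) *
          ((2 * ‖z‖) ^ N * ∏ i ∈ Finset.range N, √(((k + 1 : ℕ) : ℝ) + 1 + i))
        + ‖z‖ * √((k : ℝ) + 1) *
          ((2 * ‖z‖) ^ N * ∏ i ∈ Finset.range N, √(((k + 1 : ℕ) : ℝ) + 1 + i)) := by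
          gcongr
      _ = _ := by ring

lemma summable_norm_displacementTerm (b : HilbertBasis ℕ ℂ H) (z : ℂ) (k : ℕ) :
    Summable fun N => ‖displacementTerm b z k N‖ := by
  set c : ℝ := 2 * ‖z‖ + 1 with hc
  have hc0 : 0 < c := by positivity
  set g : ℕ → ℝ := fun N =>
    (N.factorial : ℝ)⁻¹ * (c ^ N * ∏ i ∈ Finset.range N, √((k : ℝ) + 1 + i)) with hg
  have hpos : ∀ N, 0 < g N := by
    intro N
    have : 0 < ∏ i ∈ Finset.range N, √((k : ℝ) + 1 + i) :=
      Finset.prod_pos fun i _ => Real.sqrt_pos.2 (by positivity)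
    positivity
  have hs : Summable g := by
    refine summable_of_ratio_test_tendsto_lt_one (l := 0) one_pos
      (Eventually.of_forall fun N => (hpos N).ne') ?_
    have hr : ∀ N : ℕ, ‖g (N + 1)‖ / ‖g N‖ = c * (√((k : ℝ) + 1 + N) / ((N : ℝ) + 1)) := by
      intro N
      rw [Real.norm_of_nonneg (hpos _).le, Real.norm_of_nonneg (hpos _).le,
        div_eq_iff (hpos N).ne', hg]
      simp only [Finset.prod_range_succ, Nat.factorial_succ, pow_succ]
      push_cast
      field_simp
    simp only [hr]
    rw [← mul_zero c]
    refine Tendsto.const_mul c ?_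
    have hup : ∀ N : ℕ, √((k : ℝ) + 1 + N) / ((N : ℝ) + 1) ≤
        √((k : ℝ) + 1) * (1 / √((N : ℝ) + 1)) := by
      intro N
      have hN : 0 < √((N : ℝ) + 1) := Real.sqrt_pos.2 (by positivity)
      rw [mul_one_div, div_le_div_iff₀ (by positivity) hN, ← Real.sqrt_mul (by positivity)]
      nth_rewrite 2 [← Real.sqrt_sq (by positivity : (0 : ℝ) ≤ (N : ℝ) + 1)]
      rw [← Real.sqrt_mul (by positivity)]
      apply Real.sqrt_le_sqrt
      have hk : (0 : ℝ) ≤ k := by positivity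
      have hN' : (0 : ℝ) ≤ N := by positivity
      nlinarith [mul_nonneg hk hN', mul_nonneg hN' hN', mul_nonneg (mul_nonneg hk hN') hN']
    refine squeeze_zero (fun N => by positivity) hup ?_
    rw [← mul_zero (√((k : ℝ) + 1))]
    refine Tendsto.const_mul _ ?_
    have := (Real.tendsto_sqrt_atTop.comp
      (tendsto_atTop_add_const_right _ (1 : ℝ) tendsto_natCast_atTop_atTop)).inv_tendsto_atTop
    simpa [Function.comp_def, Pi.inv_def] using this
  refine Summable.of_nonneg_of_le (fun _ => norm_nonneg _) (fun N => ?_) hs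
  rw [displacementTerm, norm_smul, norm_inv, Complex.norm_natCast]
  refine mul_le_mul_of_nonneg_left ((norm_fockVector_pow_le b z N k).trans ?_) (by positivity)
  refine mul_le_mul_of_nonneg_right ?_ (Finset.prod_nonneg fun _ _ => Real.sqrt_nonneg _)
  gcongr
  linarith

lemma inner_displacementExponent (b : HilbertBasis ℕ ℂ H) (z : ℂ) (v w : ℕ →₀ ℂ) :
    inner ℂ (fockVector b v) (fockVector b (displacementExponent z w)) =
      - inner ℂ (fockVector b (displacementExponent z v)) (fockVector b w) := by
  induction v using Finsupp.induction_linear with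
  | zero => simp
  | add v₁ v₂ h₁ h₂ => simp only [map_add, inner_add_left, h₁, h₂]; ring
  | single k α =>
    induction w using Finsupp.induction_linear with
    | zero => simp
    | add w₁ w₂ h₁ h₂ => simp only [map_add, inner_add_right, h₁, h₂]; ring
    | single l β =>
      have hα : Finsupp.single k α = α • Finsupp.single k (1 : ℂ) := by simp
      have hβ : Finsupp.single l β = β • Finsupp.single l (1 : ℂ) := by simp
      have hf : ∀ m, fockVector b (Finsupp.single m (1 : ℂ)) = b m := by
        intro m; simp [fockVector]
      rw [hα, hβ]
      simp only [map_smul, displacementExponent_single, map_sub, hf, inner_smul_left,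
        inner_smul_right, inner_sub_left, inner_sub_right, orthonormal_iff_ite.1 b.orthonormal,
        map_mul, Complex.conj_conj, Complex.conj_ofReal]
      have e1 : ((√((l : ℝ) + 1) : ℝ) : ℂ) * (if k = l + 1 then 1 else 0) =
          ((√(k : ℝ) : ℝ) : ℂ) * (if k - 1 = l then 1 else 0) := by
        rcases k with _ | k
        · simp
        · by_cases h : k = l
          · subst h; simp
          · simp [h]
      have e2 : ((√((k : ℝ) + 1) : ℝ) : ℂ) * (if k + 1 = l then 1 else 0) =
          ((√(l : ℝ) : ℝ) : ℂ) * (if k = l - 1 then 1 else 0) := by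
        rcases l with _ | l
        · simp
        · by_cases h : k = l
          · subst h; simp
          · simp [h]
      linear_combination (conj α * β * z) * e1 + (conj α * β * conj z) * e2

lemma inner_displacementExponent_pow (b : HilbertBasis ℕ ℂ H) (z : ℂ) (N : ℕ)
    (v w : ℕ →₀ ℂ) :
    inner ℂ (fockVector b ((displacementExponent z ^ N) v)) (fockVector b w) =
      (-1) ^ N * inner ℂ (fockVector b v) (fockVector b ((displacementExponent z ^ N) w)) := by
  induction N generalizing w with
  | zero => simp
  | succ N ih =>
    rw [pow_succ', Module.End.mul_apply, ← neg_eq_iff_eq_neg.2 (inner_displacementExponent b z _ _),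
      ih, ← Module.End.mul_apply, ← pow_succ, ← pow_succ']
    ring

/-- `V_j : |j,m⟩ ↦ |j - m⟩` with `j = d / 2`. -/
def spinEmbedding (b : HilbertBasis ℕ ℂ H) (d : ℕ) :
    EuclideanSpace ℂ (Fin (d + 1)) →L[ℂ] H :=
  ∑ k : Fin (d + 1), InnerProductSpace.rankOne ℂ (b k) (EuclideanSpace.single k (1 : ℂ))

lemma spinEmbedding_single (b : HilbertBasis ℕ ℂ H) (d : ℕ) (k : Fin (d + 1)) :
    spinEmbedding b d (EuclideanSpace.single k 1) = b k := by
  simp [spinEmbedding, InnerProductSpace.rankOne_apply, EuclideanSpace.inner_single_left]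

variable [CompleteSpace H]

lemma orthonormal_displacedLevel (b : HilbertBasis ℕ ℂ H) (z : ℂ) :
    Orthonormal ℂ (displacedLevel b z) := by
  rw [orthonormal_iff_ite]
  intro k l
  have hk := summable_norm_displacementTerm b z k
  have hl := summable_norm_displacementTerm b z l
  have hks := hk.of_norm
  have hls := hl.of_norm
  set f : ℕ × ℕ → ℂ := fun q =>
    inner ℂ (displacementTerm b z k q.1) (displacementTerm b z l q.2) with hf
  have hfs : Summable f := by
    refine Summable.of_norm_bounded (hk.mul_of_nonneg hl (fun _ => norm_nonneg _)
      fun _ => norm_nonneg _) fun q => norm_inner_le_norm _ _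
  have h1 : inner ℂ (displacedLevel b z k) (displacedLevel b z l) = ∑' q, f q := by
    rw [hfs.tsum_prod, displacedLevel, displacedLevel]
    have e1 : ∀ y : H, inner ℂ (∑' N, displacementTerm b z k N) y =
        ∑' N, inner ℂ (displacementTerm b z k N) y := by
      intro y
      have h := ((innerSL ℂ y).hasSum hks.hasSum)
      simpa using h.star.tsum_eq.symm
    rw [e1]
    refine tsum_congr fun N => ?_
    exact ((innerSL ℂ (displacementTerm b z k N)).hasSum hls.hasSum).tsum_eq.symm
  have h2 : ∑' q, f q = ∑' n, ∑ q ∈ Finset.HasAntidiagonal.antidiagonal n, f q := by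
    rw [← Finset.HasAntidiagonal.sigmaAntidiagonalEquivProd.tsum_eq f]
    refine (Summable.tsum_sigma'
        (fun n => (hasSum_fintype _).summable)
        (Finset.HasAntidiagonal.sigmaAntidiagonalEquivProd.summable_iff.2 hfs)).trans ?_
    refine tsum_congr fun n => ?_
    rw [tsum_fintype, ← Finset.sum_attach (Finset.HasAntidiagonal.antidiagonal n)]
    rfl
  have h3 : ∀ n, ∑ q ∈ Finset.HasAntidiagonal.antidiagonal n, f q =
      if n = 0 then inner ℂ (b k) (b l) else 0 := by
    intro n
    set I : ℂ := inner ℂ (fockVector b (Finsupp.single k 1))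
      (fockVector b ((displacementExponent z ^ n) (Finsupp.single l 1))) with hI
    have hterm : ∀ q ∈ Finset.HasAntidiagonal.antidiagonal n, f q =
        (n.factorial : ℂ)⁻¹ * I * (n.choose q.1 • ((-1 : ℂ) ^ q.1 * 1 ^ q.2)) := by
      rintro ⟨i, j⟩ hq
      rw [Finset.HasAntidiagonal.mem_antidiagonal] at hq
      simp only at hq
      subst hq
      have hch : ((i + j).choose i : ℂ) =
          (i + j).factorial * (i.factorial : ℂ)⁻¹ * (j.factorial : ℂ)⁻¹ := by
        rw [Nat.cast_add_choose]
        field_simp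
      simp only [hf, displacementTerm, inner_smul_left, inner_smul_right,
        inner_displacementExponent_pow, one_pow, mul_one, nsmul_eq_mul, hch]
      rw [← Module.End.mul_apply, ← pow_add, ← hI]
      have : ((i + j).factorial : ℂ) ≠ 0 := by exact_mod_cast Nat.factorial_ne_zero _
      simp only [map_inv₀, map_natCast]
      field_simp
    rw [Finset.sum_congr rfl hterm, ← Finset.mul_sum,
      ← Commute.add_pow' (Commute.all (-1 : ℂ) 1) n]
    by_cases hn : n = 0
    · subst hn; simp [hI, fockVector]
    · simp [hn]
  rw [h1, h2]
  simp only [h3, tsum_ite_eq]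
  exact orthonormal_iff_ite.1 b.orthonormal k l

/-- The displacement operator `D(z) = exp (z a^* - z̄ a)`: the continuous linear extension of
`|k⟩ ↦ exp (z a^* - z̄ a) |k⟩`, the energy levels being analytic vectors for the exponent. -/
def displacement (b : HilbertBasis ℕ ℂ H) (z : ℂ) : H →ₗᵢ[ℂ] H :=
  (orthonormal_displacedLevel b z).orthogonalFamily.linearIsometry.comp
    b.repr.toLinearIsometry

lemma displacement_basis (b : HilbertBasis ℕ ℂ H) (z : ℂ) (k : ℕ) :
    displacement b z (b k) = ∑' N : ℕ, ((N.factorial : ℂ)⁻¹) •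
      fockVector b ((displacementExponent z ^ N) (Finsupp.single k 1)) := by
  change _ = displacedLevel b z k
  classical
  change (orthonormal_displacedLevel b z).orthogonalFamily.linearIsometry (b.repr (b k)) = _
  rw [b.repr_self, OrthogonalFamily.linearIsometry_apply_single]
  simp

/-- The thermal equilibrium state `φ^0 = (1 - p) ∑_k p^k |k⟩⟨k|`. -/
def thermalState (b : HilbertBasis ℕ ℂ H) (μ : ℝ) : H →L[ℂ] H :=
  ∑' k : ℕ, (((1 - thermalRatio μ) * thermalRatio μ ^ k : ℝ) : ℂ) •
    InnerProductSpace.rankOne ℂ (b k) (b k)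

/-- `α_u = -u_y + i u_x`. -/
def alpha (u : ℝ × ℝ) : ℂ := -(u.2 : ℂ) + Complex.I * (u.1 : ℂ)

/-- The displaced thermal state `φ^u = D(√(2μ-1) α_u) φ^0 D(√(2μ-1) α_u)^*`. -/
def displacedThermalState (b : HilbertBasis ℕ ℂ H) (μ : ℝ) (u : ℝ × ℝ) : H →L[ℂ] H :=
  let D : H →L[ℂ] H :=
    (displacement b (((√(2 * μ - 1) : ℝ) : ℂ) * alpha u)).toContinuousLinearMap
  D ∘L thermalState b μ ∘L ContinuousLinearMap.adjoint D

/-- The embedded block state `V_j ρ^u_{j,n} V_j^*` with `j = d / 2`. -/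
def embeddedBlockState (b : HilbertBasis ℕ ℂ H) (μ : ℝ) (n d : ℕ) (u : ℝ × ℝ) : H →L[ℂ] H :=
  spinEmbedding b d ∘L Matrix.toEuclideanCLM (𝕜 := ℂ) (blockState μ n d u) ∘L
    ContinuousLinearMap.adjoint (spinEmbedding b d)

/-- The trace norm `‖T‖₁ = Tr |T| = ∑_k ⟨k| |T| |k⟩ ∈ [0, ∞]`, where `|T| = (T^* T)^{1/2}`. -/
def traceNorm (b : HilbertBasis ℕ ℂ H) (T : H →L[ℂ] H) : ℝ≥0∞ :=
  ∑' k : ℕ, ENNReal.ofReal (RCLike.re (inner ℂ (b k) (CFC.abs T (b k))))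

end Oscillator

end

end QubitLAN

/-! Both states are explicit mixtures of pure states indexed by the level `k`. The embedded block
state has eigenvalues `(1-p)/(1-p^(d+1)) p^k` with eigenvectors `V_j U_j |k⟩` for `k ≤ d = 2j`; the
displaced thermal state has eigenvalues `(1-p) p^k` with eigenvectors `D|k⟩`. For weights `r k`, `s
k` and vectors `x k`, `y k` of norm at most one, the trace norm of the difference is at most `∑ (|r
k - s k| + 2 s k ‖x k - y k‖)` (`traceNorm_le_of_hasSum_rankOne`). Here the summand is at most `6
p^k`, so by dominated convergence each `k` may be treated alone.

The eigenvalues converge because `d → ∞` and `p < 1`. For the eigenvectors, carry the spin generator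
over to the levels `0, …, d`. It is the oscillator exponent `α a^* - ᾱ a`, except that the matrix
elements between `k` and `k + 1` are multiplied by `√((d-k)/n)` (`spinGenerator_column`). For
typical spins `d/n → 2μ-1`, so every weight tends to `√(2μ-1)`, and the constant weight `√(2μ-1)`
gives exactly the exponent of `D(√(2μ-1) α)`. The `N`-th term of the exponential series on `|k⟩`
involves finitely many weights, hence converges. Since the weights are at most one, it also has a
summable bound uniform in all parameters (`norm_weightedTerm_le`), and
`tendsto_tsum_weightedTerm_sub` sums the limits.

Uniformity in `d` and `u` comes from taking every limit along one filter on triples `(n, d, u)`. The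
vector `D|k⟩` depends on `u`, which does not converge, so only differences are shown to tend to
zero; boundedness of `u` suffices for this. -/

namespace QubitLAN

/-! ### Bounding the trace norm -/

section TraceNorm

variable {H : Type*} [NormedAddCommGroup H] [InnerProductSpace ℂ H]

/-- All partial traces of `S T`, for `S` a contraction, are at most `C`. -/
def PartialTraceBound (b : HilbertBasis ℕ ℂ H) (T : H →L[ℂ] H) (C : ℝ) : Prop :=
  ∀ (S : H →L[ℂ] H) (F : Finset ℕ), ‖S‖ ≤ 1 →
    ∑ k ∈ F, RCLike.re (inner ℂ (b k) (S (T (b k)))) ≤ C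

lemma PartialTraceBound.add {b : HilbertBasis ℕ ℂ H} {T₁ T₂ : H →L[ℂ] H} {C₁ C₂ : ℝ}
    (h₁ : PartialTraceBound b T₁ C₁) (h₂ : PartialTraceBound b T₂ C₂) :
    PartialTraceBound b (T₁ + T₂) (C₁ + C₂) := by
  intro S F hS
  simpa [inner_add_right, Finset.sum_add_distrib] using add_le_add (h₁ S F hS) (h₂ S F hS)

/-- The summand is `⟨y, b k⟩ ⟨b k, S x⟩`, so Cauchy–Schwarz over `F` and Bessel's inequality for `S
x` and `y` give the bound. -/
lemma partialTraceBound_rankOne (b : HilbertBasis ℕ ℂ H) (x y : H) :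
    PartialTraceBound b (InnerProductSpace.rankOne ℂ x y) (‖x‖ * ‖y‖) := by
  intro S F hS
  have hSx : ‖S x‖ ≤ ‖x‖ := (S.le_opNorm x).trans (mul_le_of_le_one_left (norm_nonneg _) hS)
  have hb := b.orthonormal
  calc ∑ k ∈ F, RCLike.re (inner ℂ (b k) (S (InnerProductSpace.rankOne ℂ x y (b k))))
      ≤ ∑ k ∈ F, ‖inner ℂ (b k) (S x)‖ * ‖inner ℂ (b k) y‖ := by
        refine Finset.sum_le_sum fun k _ => (RCLike.re_le_norm _).trans ?_
        rw [InnerProductSpace.rankOne_apply, map_smul, inner_smul_right, norm_mul, mul_comm,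
          norm_inner_symm y]
    _ ≤ √(∑ k ∈ F, ‖inner ℂ (b k) (S x)‖ ^ 2) * √(∑ k ∈ F, ‖inner ℂ (b k) y‖ ^ 2) :=
        Real.sum_mul_le_sqrt_mul_sqrt _ _ _
    _ ≤ √(‖S x‖ ^ 2) * √(‖y‖ ^ 2) := by
        gcongr
        · exact hb.sum_inner_products_le (S x)
        · exact hb.sum_inner_products_le y
    _ ≤ ‖x‖ * ‖y‖ := by
        rw [Real.sqrt_sq (norm_nonneg _), Real.sqrt_sq (norm_nonneg _)]
        gcongr

/-- For fixed `S` and `F` the partial trace is additive and continuous in `T`. This makes countable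
subadditivity immediate, whereas `|T|` itself is not additive in `T`. -/
lemma partialTraceBound_of_hasSum {b : HilbertBasis ℕ ℂ H} {ι : Type*} {t : ι → H →L[ℂ] H}
    {c : ι → ℝ} {T : H →L[ℂ] H} (ht : HasSum t T) (hc : Summable c)
    (h : ∀ i, PartialTraceBound b (t i) (c i)) : PartialTraceBound b T (∑' i, c i) := by
  intro S F hS
  have hsum : HasSum (fun i => ∑ k ∈ F, RCLike.re (inner ℂ (b k) (S (t i (b k)))))
      (∑ k ∈ F, RCLike.re (inner ℂ (b k) (S (T (b k))))) := by
    refine hasSum_sum fun k _ => ?_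
    exact ht.map (AddMonoidHom.mk' (fun A : H →L[ℂ] H => RCLike.re (inner ℂ (b k) (S (A (b k)))))
      (by intros; simp)) (by
        change Continuous fun A : H →L[ℂ] H => RCLike.re (inner ℂ (b k) (S (A (b k))))
        fun_prop)
  exact hasSum_le (fun i => h i S F hS) hsum hc.hasSum

variable [CompleteSpace H]

/-- Up to an error `δ` in norm, `|T|` is the product of a contraction with `T`. -/
lemma exists_contraction_mul_near_abs {T : H →L[ℂ] H} (hT : IsSelfAdjoint T) {δ : ℝ}
    (hδ : 0 < δ) : ∃ S : H →L[ℂ] H, ‖S‖ ≤ 1 ∧ ‖CFC.abs T - S * T‖ ≤ δ := by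
  have hpos : ∀ x : ℝ, 0 < ‖x‖ + δ := fun x => by positivity
  have hcont : Continuous fun x : ℝ => x / (‖x‖ + δ) :=
    continuous_id.div (by fun_prop) fun x => (hpos x).ne'
  -- The function `x / (|x| + δ)` is a continuous substitute for the sign, as the continuous
  -- functional calculus requires. The error `|x| - x² / (|x| + δ) = δ |x| / (|x| + δ)` is at most
  -- `δ`.
  refine ⟨cfc (fun x : ℝ => x / (‖x‖ + δ)) T, norm_cfc_le zero_le_one fun x _ => ?_, ?_⟩
  · rw [norm_div, Real.norm_of_nonneg (hpos x).le, div_le_one (hpos x)]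
    linarith
  · have h : CFC.abs T - cfc (fun x : ℝ => x / (‖x‖ + δ)) T * T =
        cfc (fun x : ℝ => ‖x‖ - x / (‖x‖ + δ) * x) T := by
      rw [CFC.abs_eq_cfc_norm T hT,
        cfc_sub (fun x : ℝ => ‖x‖) (fun x => x / (‖x‖ + δ) * x) T continuous_norm.continuousOn
          (hcont.mul continuous_id).continuousOn,
        cfc_mul (fun x : ℝ => x / (‖x‖ + δ)) (fun x => x) T hcont.continuousOn
          continuous_id.continuousOn, cfc_id' ℝ T hT]
    rw [h]
    refine norm_cfc_le hδ.le fun x _ => ?_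
    have hx : ‖x‖ - x / (‖x‖ + δ) * x = δ * (‖x‖ / (‖x‖ + δ)) := by
      have := (hpos x).ne'
      have hxx : x * x = ‖x‖ * ‖x‖ := (abs_mul_abs_self x).symm
      field_simp
      linear_combination -hxx
    rw [hx, norm_mul, Real.norm_of_nonneg hδ.le, norm_div, norm_norm,
      Real.norm_of_nonneg (hpos x).le]
    refine mul_le_of_le_one_right hδ.le ((div_le_one (hpos x)).2 (by linarith))

lemma traceNorm_le_of_partialTraceBound {b : HilbertBasis ℕ ℂ H} {T : H →L[ℂ] H}
    (hT : IsSelfAdjoint T) {C : ℝ} (h : PartialTraceBound b T C) :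
    traceNorm b T ≤ ENNReal.ofReal C := by
  rw [traceNorm, ENNReal.tsum_eq_iSup_sum]
  refine iSup_le fun F => ?_
  have hnn : ∀ k, 0 ≤ RCLike.re (inner ℂ (b k) (CFC.abs T (b k))) := fun k =>
    ((ContinuousLinearMap.nonneg_iff_isPositive _).1 (CFC.abs_nonneg T)).re_inner_nonneg_right _
  rw [← ENNReal.ofReal_sum_of_nonneg fun k _ => hnn k]
  refine ENNReal.ofReal_le_ofReal (le_of_forall_pos_le_add fun η hη => ?_)
  -- The error is incurred once for each `k ∈ F`, hence the division; the `+ 1` covers empty `F`.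
  obtain ⟨S, hS, hST⟩ := exists_contraction_mul_near_abs hT
    (δ := η / (F.card + 1)) (by positivity)
  have hk : ∀ k, RCLike.re (inner ℂ (b k) (CFC.abs T (b k))) ≤
      RCLike.re (inner ℂ (b k) (S (T (b k)))) + η / (F.card + 1) := by
    intro k
    have e : inner ℂ (b k) (CFC.abs T (b k)) = inner ℂ (b k) (S (T (b k))) +
        inner ℂ (b k) ((CFC.abs T - S * T) (b k)) := by
      simp
    rw [e, map_add]
    gcongr
    refine (RCLike.re_le_norm _).trans ((norm_inner_le_norm _ _).trans ?_)
    rw [b.orthonormal.1 k, one_mul]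
    refine ((CFC.abs T - S * T).le_opNorm (b k)).trans ?_
    rwa [b.orthonormal.1 k, mul_one]
  calc _ ≤ ∑ k ∈ F, (RCLike.re (inner ℂ (b k) (S (T (b k)))) + η / (F.card + 1)) :=
        Finset.sum_le_sum fun k _ => hk k
    _ = ∑ k ∈ F, RCLike.re (inner ℂ (b k) (S (T (b k)))) + F.card * (η / (F.card + 1)) := by
        rw [Finset.sum_add_distrib, Finset.sum_const, nsmul_eq_mul]
    _ ≤ C + η := by
        gcongr
        · exact h S F hS
        · rw [mul_div_left_comm]
          exact mul_le_of_le_one_right hη.le ((div_le_one (by positivity)).2 (by linarith))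

lemma isSelfAdjoint_smul_rankOne_self (r : ℝ) (x : H) :
    IsSelfAdjoint ((r : ℂ) • InnerProductSpace.rankOne ℂ x x) := by
  rw [IsSelfAdjoint, star_smul, ContinuousLinearMap.star_eq_adjoint,
    InnerProductSpace.adjoint_rankOne]
  simp

/-- The trace norm distance of two mixtures of pure states. -/
lemma traceNorm_le_of_hasSum_rankOne (b : HilbertBasis ℕ ℂ H) {T : H →L[ℂ] H}
    {r s : ℕ → ℝ} {x y : ℕ → H} (hx : ∀ k, ‖x k‖ ≤ 1) (hy : ∀ k, ‖y k‖ ≤ 1) (hs : ∀ k, 0 ≤ s k)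
    (hT : HasSum (fun k => (r k : ℂ) • InnerProductSpace.rankOne ℂ (x k) (x k) -
      (s k : ℂ) • InnerProductSpace.rankOne ℂ (y k) (y k)) T)
    (hsum : Summable fun k => |r k - s k| + 2 * s k * ‖x k - y k‖) :
    traceNorm b T ≤ ENNReal.ofReal (∑' k, (|r k - s k| + 2 * s k * ‖x k - y k‖)) := by
  have hsa : IsSelfAdjoint T := by
    have h1 := hT.star
    have h2 : (fun k => star ((r k : ℂ) • InnerProductSpace.rankOne ℂ (x k) (x k) -
        (s k : ℂ) • InnerProductSpace.rankOne ℂ (y k) (y k))) = fun k =>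
        (r k : ℂ) • InnerProductSpace.rankOne ℂ (x k) (x k) -
        (s k : ℂ) • InnerProductSpace.rankOne ℂ (y k) (y k) := by
      funext k
      exact ((isSelfAdjoint_smul_rankOne_self _ _).sub (isSelfAdjoint_smul_rankOne_self _ _)).star_eq
    rw [h2] at h1
    exact h1.unique hT
  refine traceNorm_le_of_partialTraceBound hsa (partialTraceBound_of_hasSum hT hsum fun k => ?_)
  -- Change the weight first, then one vector at a time. The two changes of vector account for the
  -- factor `2`.
  have hdecomp : (r k : ℂ) • InnerProductSpace.rankOne ℂ (x k) (x k) -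
      (s k : ℂ) • InnerProductSpace.rankOne ℂ (y k) (y k) =
      InnerProductSpace.rankOne ℂ (((r k - s k : ℝ) : ℂ) • x k) (x k) +
      (InnerProductSpace.rankOne ℂ ((s k : ℂ) • (x k - y k)) (x k) +
      InnerProductSpace.rankOne ℂ ((s k : ℂ) • y k) (x k - y k)) := by
    simp only [map_smul, map_sub, smul_apply, sub_apply,
      Complex.ofReal_sub]
    module
  rw [hdecomp]
  have hb := (partialTraceBound_rankOne b (((r k - s k : ℝ) : ℂ) • x k) (x k)).add
    ((partialTraceBound_rankOne b ((s k : ℂ) • (x k - y k)) (x k)).add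
      (partialTraceBound_rankOne b ((s k : ℂ) • y k) (x k - y k)))
  intro S F hS
  refine (hb S F hS).trans ?_
  simp only [norm_smul, Complex.norm_real, Real.norm_eq_abs, abs_of_nonneg (hs k)]
  have h1 : ‖x k‖ * ‖x k‖ ≤ 1 := mul_le_one₀ (hx k) (norm_nonneg _) (hx k)
  have h2 : s k * ‖x k - y k‖ * ‖x k‖ ≤ s k * ‖x k - y k‖ :=
    mul_le_of_le_one_right (mul_nonneg (hs k) (norm_nonneg _)) (hx k)
  have h3 : s k * ‖y k‖ * ‖x k - y k‖ ≤ s k * ‖x k - y k‖ :=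
    mul_le_mul_of_nonneg_right (mul_le_of_le_one_right (hs k) (hy k)) (norm_nonneg _)
  have h4 : |r k - s k| * ‖x k‖ * ‖x k‖ ≤ |r k - s k| := by
    rw [mul_assoc]; exact mul_le_of_le_one_right (abs_nonneg _) h1
  linarith

lemma comp_rankOne_comp_adjoint {E : Type*} [NormedAddCommGroup E] [InnerProductSpace ℂ E]
    [CompleteSpace E] (L : E →L[ℂ] H) (x y : E) :
    L ∘L InnerProductSpace.rankOne ℂ x y ∘L ContinuousLinearMap.adjoint L =
      InnerProductSpace.rankOne ℂ (L x) (L y) := by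
  ext v
  simp [ContinuousLinearMap.adjoint_inner_right]

end TraceNorm

end QubitLAN

namespace QubitLAN

/-! ### Weighted displacements -/

noncomputable section

/-- The operator `z a^* w(a^* a) - z̄ w(a^* a) a`, whose matrix elements between the
levels `k` and `k + 1` are those of the displacement exponent multiplied by `w k`. -/
def weightedExponent (z : ℂ) (w : ℕ → ℝ) : (ℕ →₀ ℂ) →ₗ[ℂ] (ℕ →₀ ℂ) :=
  Finsupp.linearCombination ℂ fun k =>
    (z * ((w k * √((k : ℝ) + 1) : ℝ) : ℂ)) • Finsupp.single (k + 1) 1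
      - (conj z * ((w (k - 1) * √(k : ℝ) : ℝ) : ℂ)) • Finsupp.single (k - 1) 1

/-- At `k = 0` the truncated `k - 1` is harmless, since its coefficient contains `√0`. -/
lemma weightedExponent_single (z : ℂ) (w : ℕ → ℝ) (k : ℕ) :
    weightedExponent z w (Finsupp.single k 1) =
      (z * ((w k * √((k : ℝ) + 1) : ℝ) : ℂ)) • Finsupp.single (k + 1) 1
        - (conj z * ((w (k - 1) * √(k : ℝ) : ℝ) : ℂ)) • Finsupp.single (k - 1) 1 := by
  simp [weightedExponent]

lemma weightedExponent_const (z : ℂ) (c : ℝ) :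
    weightedExponent z (fun _ => c) = displacementExponent (c * z) := by
  ext1 k
  ext1
  simp only [LinearMap.comp_apply, Finsupp.lsingle_apply]
  rw [weightedExponent_single, displacementExponent_single]
  congr 2
  · push_cast; ring
  · push_cast; rw [map_mul, Complex.conj_ofReal]; ring

variable {H : Type*} [NormedAddCommGroup H] [InnerProductSpace ℂ H]

/-- One application sends level `k` to `k + 1` and `k - 1`, each with a coefficient of size at most
`‖z‖ √(k+1)`. The bound increases with `k`, so the branch through `k - 1` is absorbed into the one
through `k + 1`, which gives the factor `2`. -/
lemma norm_fockVector_weightedExponent_pow_le (b : HilbertBasis ℕ ℂ H) (z : ℂ) {w : ℕ → ℝ}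
    (hw : ∀ k, |w k| ≤ 1) (N k : ℕ) :
    ‖fockVector b ((weightedExponent z w ^ N) (Finsupp.single k 1))‖ ≤
      (2 * ‖z‖) ^ N * ∏ i ∈ Finset.range N, √((k : ℝ) + 1 + i) := by
  induction N generalizing k with
  | zero => simp [fockVector, b.orthonormal.1 k]
  | succ N ih =>
    rw [pow_succ, Module.End.mul_apply, weightedExponent_single, map_sub, map_sub, map_smul,
      map_smul, map_smul, map_smul]
    refine (norm_sub_le _ _).trans ?_
    rw [norm_smul, norm_smul]
    have hP : ∏ i ∈ Finset.range (N + 1), √((k : ℝ) + 1 + i) =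
        √((k : ℝ) + 1) * ∏ i ∈ Finset.range N, √(((k + 1 : ℕ) : ℝ) + 1 + i) := by
      rw [Finset.prod_range_succ', mul_comm]
      congr 1
      · simp
      · refine Finset.prod_congr rfl fun i _ => ?_
        congr 1; push_cast; ring
    have h1 := ih (k + 1)
    have h2 := ih (k - 1)
    have hmono : ∏ i ∈ Finset.range N, √(((k - 1 : ℕ) : ℝ) + 1 + i) ≤
        ∏ i ∈ Finset.range N, √(((k + 1 : ℕ) : ℝ) + 1 + i) := by
      refine Finset.prod_le_prod (fun i _ => Real.sqrt_nonneg _) fun i _ => ?_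
      apply Real.sqrt_le_sqrt
      have : ((k - 1 : ℕ) : ℝ) ≤ ((k + 1 : ℕ) : ℝ) := by exact_mod_cast (by omega)
      linarith
    have hle : ∀ l, |w l| * √((k : ℝ) + 1) ≤ √((k : ℝ) + 1) := fun l =>
      mul_le_of_le_one_left (Real.sqrt_nonneg _) (hw l)
    have n1 : ‖z * ((w k * √((k : ℝ) + 1) : ℝ) : ℂ)‖ ≤ ‖z‖ * √((k : ℝ) + 1) := by
      rw [norm_mul, Complex.norm_real, norm_mul, Real.norm_of_nonneg (Real.sqrt_nonneg _)]
      exact mul_le_mul_of_nonneg_left (hle _) (norm_nonneg _)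
    have n2 : ‖conj z * ((w (k - 1) * √(k : ℝ) : ℝ) : ℂ)‖ ≤ ‖z‖ * √((k : ℝ) + 1) := by
      rw [norm_mul, Complex.norm_real, norm_mul, Real.norm_of_nonneg (Real.sqrt_nonneg _),
        RCLike.norm_conj]
      refine mul_le_mul_of_nonneg_left (le_trans ?_ (hle (k - 1))) (norm_nonneg _)
      rw [Real.norm_eq_abs]
      gcongr
      linarith
    rw [hP]
    have h2' := h2.trans (mul_le_mul_of_nonneg_left hmono (by positivity))
    calc _ ≤ ‖z‖ * √((k : ℝ) + 1) *
          ((2 * ‖z‖) ^ N * ∏ i ∈ Finset.range N, √(((k + 1 : ℕ) : ℝ) + 1 + i))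
        + ‖z‖ * √((k : ℝ) + 1) *
          ((2 * ‖z‖) ^ N * ∏ i ∈ Finset.range N, √(((k + 1 : ℕ) : ℝ) + 1 + i)) := by
          gcongr
      _ = _ := by ring

lemma summable_displacement_majorant (c : ℝ) (hc0 : 0 < c) (k : ℕ) :
    Summable fun N : ℕ =>
      (N.factorial : ℝ)⁻¹ * (c ^ N * ∏ i ∈ Finset.range N, √((k : ℝ) + 1 + i)) := by
  set g : ℕ → ℝ := fun N =>
    (N.factorial : ℝ)⁻¹ * (c ^ N * ∏ i ∈ Finset.range N, √((k : ℝ) + 1 + i)) with hg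
  have hpos : ∀ N, 0 < g N := by
    intro N
    have : 0 < ∏ i ∈ Finset.range N, √((k : ℝ) + 1 + i) :=
      Finset.prod_pos fun i _ => Real.sqrt_pos.2 (by positivity)
    positivity
  refine summable_of_ratio_test_tendsto_lt_one (l := 0) one_pos
    (Eventually.of_forall fun N => (hpos N).ne') ?_
  have hr : ∀ N : ℕ, ‖g (N + 1)‖ / ‖g N‖ = c * (√((k : ℝ) + 1 + N) / ((N : ℝ) + 1)) := by
    intro N
    rw [Real.norm_of_nonneg (hpos _).le, Real.norm_of_nonneg (hpos _).le,
      div_eq_iff (hpos N).ne', hg]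
    simp only [Finset.prod_range_succ, Nat.factorial_succ, pow_succ]
    push_cast
    field_simp
  simp only [hr]
  rw [← mul_zero c]
  refine Tendsto.const_mul c ?_
  -- Follows from `k + 1 + N ≤ (k + 1)(N + 1)`.
  have hup : ∀ N : ℕ, √((k : ℝ) + 1 + N) / ((N : ℝ) + 1) ≤
      √((k : ℝ) + 1) * (1 / √((N : ℝ) + 1)) := by
    intro N
    have hN : 0 < √((N : ℝ) + 1) := Real.sqrt_pos.2 (by positivity)
    rw [mul_one_div, div_le_div_iff₀ (by positivity) hN, ← Real.sqrt_mul (by positivity)]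
    nth_rewrite 2 [← Real.sqrt_sq (by positivity : (0 : ℝ) ≤ (N : ℝ) + 1)]
    rw [← Real.sqrt_mul (by positivity)]
    apply Real.sqrt_le_sqrt
    have hk : (0 : ℝ) ≤ k := by positivity
    have hN' : (0 : ℝ) ≤ N := by positivity
    nlinarith [mul_nonneg hk hN', mul_nonneg hN' hN', mul_nonneg (mul_nonneg hk hN') hN']
  refine squeeze_zero (fun N => by positivity) hup ?_
  rw [← mul_zero (√((k : ℝ) + 1))]
  refine Tendsto.const_mul _ ?_
  have := (Real.tendsto_sqrt_atTop.comp
    (tendsto_atTop_add_const_right _ (1 : ℝ) tendsto_natCast_atTop_atTop)).inv_tendsto_atTop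
  simpa [Function.comp_def, Pi.inv_def] using this

/-- The `N`-th term of the series of `exp (z a^* w(a^* a) - z̄ w(a^* a) a) |k⟩`. -/
def weightedTerm (b : HilbertBasis ℕ ℂ H) (z : ℂ) (w : ℕ → ℝ) (k N : ℕ) : H :=
  ((N.factorial : ℂ)⁻¹) • fockVector b ((weightedExponent z w ^ N) (Finsupp.single k 1))

lemma norm_weightedTerm_le (b : HilbertBasis ℕ ℂ H) {z : ℂ} {w : ℕ → ℝ} {R : ℝ}
    (hz : ‖z‖ ≤ R) (hw : ∀ k, |w k| ≤ 1) (k N : ℕ) :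
    ‖weightedTerm b z w k N‖ ≤ (N.factorial : ℝ)⁻¹ *
      ((2 * R) ^ N * ∏ i ∈ Finset.range N, √((k : ℝ) + 1 + i)) := by
  rw [weightedTerm, norm_smul, norm_inv, Complex.norm_natCast]
  refine mul_le_mul_of_nonneg_left ((norm_fockVector_weightedExponent_pow_le b z hw N k).trans ?_)
    (by positivity)
  refine mul_le_mul_of_nonneg_right ?_ (Finset.prod_nonneg fun _ _ => Real.sqrt_nonneg _)
  gcongr

lemma summable_weightedTerm [CompleteSpace H] (b : HilbertBasis ℕ ℂ H) (z : ℂ) {w : ℕ → ℝ}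
    (hw : ∀ k, |w k| ≤ 1) (k : ℕ) : Summable (weightedTerm b z w k) :=
  Summable.of_norm_bounded
    (summable_displacement_majorant (2 * (‖z‖ + 1)) (by positivity) k)
    fun N => norm_weightedTerm_le b (by linarith) hw k N

/-- Powers of the weighted exponents depend continuously on the weights, uniformly for bounded
displacements. -/
lemma tendsto_fockVector_weightedExponent_pow_sub (b : HilbertBasis ℕ ℂ H) {α : Type*}
    {l : Filter α} {z : α → ℂ} {w : α → ℕ → ℝ} {w' : ℕ → ℝ} {R : ℝ} (hz : ∀ᶠ x in l, ‖z x‖ ≤ R)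
    (hw : ∀ᶠ x in l, ∀ k, |w x k| ≤ 1)
    (hlim : ∀ k, Tendsto (fun x => w x k) l (𝓝 (w' k))) (N k : ℕ) :
    Tendsto (fun x => fockVector b ((weightedExponent (z x) (w x) ^ N) (Finsupp.single k 1)) -
      fockVector b ((weightedExponent (z x) w' ^ N) (Finsupp.single k 1))) l (𝓝 0) := by
  induction N generalizing k with
  | zero => simpa using tendsto_const_nhds
  | succ N ih =>
    set v : α → ℕ → H := fun x m =>
      fockVector b ((weightedExponent (z x) (w x) ^ N) (Finsupp.single m 1)) with hv
    set v' : α → ℕ → H := fun x m =>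
      fockVector b ((weightedExponent (z x) w' ^ N) (Finsupp.single m 1)) with hv'
    have hvb : ∀ m, IsBoundedUnder (· ≤ ·) l fun x => ‖v x m‖ := by
      intro m
      refine ⟨(2 * R) ^ N * ∏ i ∈ Finset.range N, √((m : ℝ) + 1 + i), ?_⟩
      rw [eventually_map]
      filter_upwards [hz, hw] with x hx hwx
      refine (norm_fockVector_weightedExponent_pow_le b (z x) hwx N m).trans
        (mul_le_mul_of_nonneg_right ?_ (Finset.prod_nonneg fun _ _ => Real.sqrt_nonneg _))
      gcongr
    -- The product rule for differences: `(w - w') v` is null times bounded, and `w' (v - v')` is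
    -- null by induction. It is applied with `c = z` for the upward step and `c = z̄` for the
    -- downward one.
    have hstep : ∀ (c : α → ℂ) (s : ℝ) (m j : ℕ), (∀ x, ‖c x‖ = ‖z x‖) →
        Tendsto (fun x => (c x * ((w x j * s : ℝ) : ℂ)) • v x m -
          (c x * ((w' j * s : ℝ) : ℂ)) • v' x m) l (𝓝 0) := by
      intro c s m j hc
      have hcb : IsBoundedUnder (· ≤ ·) l fun x => ‖c x‖ := by
        refine ⟨R, ?_⟩
        rw [eventually_map]
        filter_upwards [hz] with x hx
        rw [hc]; exact hx
      have e : ∀ x, (c x * ((w x j * s : ℝ) : ℂ)) • v x m - (c x * ((w' j * s : ℝ) : ℂ)) • v' x m =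
          c x • ((((w x j - w' j) * s : ℝ) : ℂ) • v x m +
            ((w' j * s : ℝ) : ℂ) • (v x m - v' x m)) := by
        intro x
        push_cast
        module
      simp only [e]
      have t1 : Tendsto (fun x => ((((w x j - w' j) * s : ℝ) : ℂ))) l (𝓝 0) := by
        have := ((hlim j).sub_const (w' j)).mul_const s
        rw [sub_self, zero_mul] at this
        exact_mod_cast (Complex.continuous_ofReal.tendsto 0).comp this
      have t2 := t1.zero_smul_isBoundedUnder_le (hvb m)
      have t3 := (ih m).const_smul ((w' j * s : ℝ) : ℂ)
      rw [smul_zero] at t3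
      have t4 := t2.add t3
      rw [add_zero] at t4
      exact hcb.smul_tendsto_zero t4
    have h1 := hstep z (√((k : ℝ) + 1)) (k + 1) k fun _ => rfl
    have h2 := hstep (fun x => conj (z x)) (√(k : ℝ)) (k - 1) (k - 1) fun x => RCLike.norm_conj _
    have h3 := h1.sub h2
    rw [sub_zero] at h3
    refine h3.congr fun x => ?_
    rw [pow_succ, pow_succ, Module.End.mul_apply, Module.End.mul_apply, weightedExponent_single,
      weightedExponent_single]
    simp only [map_sub, map_smul, hv, hv']
    abel

lemma tendsto_tsum_weightedTerm_sub [CompleteSpace H] (b : HilbertBasis ℕ ℂ H) {α : Type*}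
    {l : Filter α} {z : α → ℂ} {w : α → ℕ → ℝ} {w' : ℕ → ℝ} {R : ℝ} (hz : ∀ᶠ x in l, ‖z x‖ ≤ R)
    (hw : ∀ᶠ x in l, ∀ k, |w x k| ≤ 1) (hw' : ∀ k, |w' k| ≤ 1)
    (hlim : ∀ k, Tendsto (fun x => w x k) l (𝓝 (w' k))) (k : ℕ) :
    Tendsto (fun x => ∑' N, weightedTerm b (z x) (w x) k N - ∑' N, weightedTerm b (z x) w' k N)
      l (𝓝 0) := by
  have key := tendsto_tsum_of_dominated_convergence (𝓕 := l)
    (f := fun x N => weightedTerm b (z x) (w x) k N - weightedTerm b (z x) w' k N)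
    (g := fun _ => (0 : H))
    -- `|R| + 1` replaces `R` because the majorant needs a positive constant and the sign of `R` is
    -- unknown.
    ((summable_displacement_majorant (2 * (|R| + 1)) (by positivity) k).mul_left 2)
    (fun N => ?_) ?_
  · rw [tsum_zero] at key
    refine key.congr' ?_
    filter_upwards [hw] with x hx
    exact (summable_weightedTerm b (z x) hx k).tsum_sub (summable_weightedTerm b (z x) hw' k)
  · have h := (tendsto_fockVector_weightedExponent_pow_sub b hz hw hlim N k).const_smul
      ((N.factorial : ℂ)⁻¹)
    rw [smul_zero] at h
    refine h.congr fun x => ?_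
    rw [smul_sub]; rfl
  · filter_upwards [hz, hw] with x hx hwx N
    have hR : ‖z x‖ ≤ |R| + 1 := hx.trans ((le_abs_self R).trans (by linarith))
    refine (norm_sub_le _ _).trans ?_
    have h1 := norm_weightedTerm_le b hR hwx k N
    have h2 := norm_weightedTerm_le b hR hw' k N
    linarith

/-! ### The spin representation in terms of weighted displacements -/

/-- The weights `√((d - k) / n)` by which the rescaled spin ladder operators differ from those of
the oscillator. They vanish for `k ≥ d`. -/
def spinWeight (n d : ℕ) (k : ℕ) : ℝ := √(((d : ℝ) - k) / n)

lemma abs_spinWeight_le_one {n d : ℕ} (h : d ≤ n) (k : ℕ) : |spinWeight n d k| ≤ 1 := by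
  rw [spinWeight, abs_of_nonneg (Real.sqrt_nonneg _), Real.sqrt_le_iff]
  refine ⟨zero_le_one, ?_⟩
  rw [one_pow]
  have : (d : ℝ) ≤ n := by exact_mod_cast h
  refine div_le_one_of_le₀ ?_ (Nat.cast_nonneg n)
  have : (0 : ℝ) ≤ k := Nat.cast_nonneg k
  linarith

/-- The generator `2 i (u_x J_x + u_y J_y) / √n`. -/
def spinGenerator (n d : ℕ) (u : ℝ × ℝ) : Matrix (Fin (d + 1)) (Fin (d + 1)) ℂ :=
  Complex.I • (((localParam n u).1 : ℂ) • ((2 : ℂ) • spinX d) +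
    ((localParam n u).2 : ℂ) • ((2 : ℂ) • spinY d) + ((0 : ℝ) : ℂ) • ((2 : ℂ) • spinZ d))

/-- Lowering `m` raises the level `k = j - m`, so `J_-` plays the role of `a^*`. Its coefficient `i
u_x - u_y` is `α`, which explains the form of `alpha`. -/
lemma spinGenerator_eq (n d : ℕ) (u : ℝ × ℝ) :
    spinGenerator n d u = (√(n : ℝ) : ℂ)⁻¹ •
      (alpha u • spinLower d - conj (alpha u) • spinRaise d) := by
  ext i j
  simp only [spinGenerator, localParam, spinX, spinY, alpha, Matrix.smul_apply, Matrix.add_apply,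
    Matrix.sub_apply, smul_eq_mul, map_add, map_neg, map_mul, Complex.conj_ofReal, Complex.conj_I]
  push_cast
  have hI : (1 / (2 * Complex.I) : ℂ) = -Complex.I / 2 := by
    field_simp
    simp
  rw [hI]
  generalize (√(n : ℝ) : ℂ) = s
  linear_combination (-(u.2 : ℂ) / s * (spinRaise d i j - spinLower d i j)) * Complex.I_sq

lemma conjTranspose_spinRaise (d : ℕ) : (spinRaise d)ᴴ = spinLower d := by
  ext i j
  by_cases h : (i : ℕ) = j + 1
  · rw [Matrix.conjTranspose_apply]
    simp only [spinRaise, spinLower, Matrix.of_apply, h, if_true]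
    push_cast
    rw [show (d : ℝ) - ((j : ℕ) + 1) + 1 = d - (j : ℕ) by ring]
    simp
  · rw [Matrix.conjTranspose_apply]
    simp only [spinRaise, spinLower, Matrix.of_apply, h, Ne.symm h, if_false]
    simp

lemma conjTranspose_spinGenerator (n d : ℕ) (u : ℝ × ℝ) :
    (spinGenerator n d u)ᴴ = - spinGenerator n d u := by
  have hL : (spinLower d)ᴴ = spinRaise d := by
    rw [← conjTranspose_spinRaise, Matrix.conjTranspose_conjTranspose]
  rw [spinGenerator_eq, Matrix.conjTranspose_smul, Matrix.conjTranspose_sub,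
    Matrix.conjTranspose_smul, Matrix.conjTranspose_smul, conjTranspose_spinRaise, hL]
  simp only [star_inv₀, RCLike.star_def, Complex.conj_ofReal, Complex.conj_conj]
  rw [← smul_neg, neg_sub]

/-- The ladder element `√(k+1) √(d-k) / √n` is the oscillator element `√(k+1)` times the weight. The
weight vanishes at `k = d`, so the levels up to `d` span an invariant subspace and the agreement is
exact, including at the top level. -/
lemma spinGenerator_column (n d : ℕ) (u : ℝ × ℝ) (k : Fin (d + 1)) :
    weightedExponent (alpha u) (spinWeight n d) (Finsupp.single (k : ℕ) 1) =
      ∑ m : Fin (d + 1), spinGenerator n d u m k • Finsupp.single (m : ℕ) (1 : ℂ) := by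
  have hkd : (k : ℕ) ≤ d := Nat.lt_succ_iff.1 k.isLt
  have hkd' : ((k : ℕ) : ℝ) ≤ d := by exact_mod_cast hkd
  have hlower : ∑ m : Fin (d + 1), ((√(n : ℝ) : ℂ)⁻¹ * (alpha u * spinLower d m k)) •
      Finsupp.single (m : ℕ) (1 : ℂ) =
      (alpha u * ((spinWeight n d k * √(((k : ℕ) : ℝ) + 1) : ℝ) : ℂ)) •
        Finsupp.single ((k : ℕ) + 1) 1 := by
    rcases hkd.lt_or_eq with hlt | heq
    · rw [Finset.sum_eq_single (⟨(k : ℕ) + 1, by omega⟩ : Fin (d + 1))]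
      · simp only [spinLower, Matrix.of_apply, if_true]
        congr 1
        rw [spinWeight, Real.sqrt_div (by linarith)]
        push_cast
        ring
      · intro m _ hm
        have : ¬ (m : ℕ) = k + 1 := fun h => hm (Fin.ext h)
        simp [spinLower, this]
      · simp
    · rw [Finset.sum_eq_zero]
      · simp [spinWeight, heq]
      · intro m _
        have : ¬ (m : ℕ) = k + 1 := by have := m.isLt; omega
        simp [spinLower, this]
  have hraise : ∑ m : Fin (d + 1), ((√(n : ℝ) : ℂ)⁻¹ * (conj (alpha u) * spinRaise d m k)) •
      Finsupp.single (m : ℕ) (1 : ℂ) =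
      (conj (alpha u) * ((spinWeight n d ((k : ℕ) - 1) * √((k : ℕ) : ℝ) : ℝ) : ℂ)) •
        Finsupp.single ((k : ℕ) - 1) 1 := by
    rcases Nat.eq_zero_or_pos (k : ℕ) with h0 | hpos
    · rw [Finset.sum_eq_zero]
      · simp [h0]
      · intro m _
        simp [spinRaise, h0]
    · rw [Finset.sum_eq_single (⟨(k : ℕ) - 1, by omega⟩ : Fin (d + 1))]
      · simp only [spinRaise, Matrix.of_apply, Nat.sub_add_cancel hpos, if_true]
        congr 1
        rw [spinWeight, Nat.cast_sub hpos, Real.sqrt_div (by push_cast; linarith),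
          show (d : ℝ) - (((k : ℕ) : ℝ) - ((1 : ℕ) : ℝ)) = d - (k : ℕ) + 1 by push_cast; ring]
        push_cast
        ring
      · intro m _ hm
        have : ¬ (m : ℕ) + 1 = k := fun h => hm (Fin.ext (by simp; omega))
        simp [spinRaise, this]
      · simp
  rw [weightedExponent_single, ← hlower, ← hraise, ← Finset.sum_sub_distrib]
  refine Finset.sum_congr rfl fun m _ => ?_
  rw [← sub_smul, spinGenerator_eq]
  congr 1
  simp only [Matrix.smul_apply, Matrix.sub_apply, smul_eq_mul]
  ring

lemma weightedExponent_pow_single (n d : ℕ) (u : ℝ × ℝ) (N : ℕ) (k : Fin (d + 1)) :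
    (weightedExponent (alpha u) (spinWeight n d) ^ N) (Finsupp.single (k : ℕ) 1) =
      ∑ m : Fin (d + 1), (spinGenerator n d u ^ N) m k • Finsupp.single (m : ℕ) (1 : ℂ) := by
  induction N with
  | zero => simp [Matrix.one_apply]
  | succ N ih =>
    rw [pow_succ', Module.End.mul_apply, ih, map_sum]
    simp only [map_smul, spinGenerator_column, Finset.smul_sum, smul_smul]
    rw [Finset.sum_comm]
    refine Finset.sum_congr rfl fun m _ => ?_
    rw [← Finset.sum_smul, pow_succ', Matrix.mul_apply]
    congr 1
    exact Finset.sum_congr rfl fun j _ => mul_comm _ _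

/-- The vector `V_j A |j, j - k⟩`. -/
def embeddedColumn (b : HilbertBasis ℕ ℂ H) (d : ℕ) (k : Fin (d + 1)) :
    Matrix (Fin (d + 1)) (Fin (d + 1)) ℂ →ₗ[ℂ] H where
  toFun A := ∑ m : Fin (d + 1), A m k • b m
  map_add' A B := by simp [add_smul, Finset.sum_add_distrib]
  map_smul' c A := by simp [Finset.smul_sum, smul_smul]

lemma continuous_embeddedColumn (b : HilbertBasis ℕ ℂ H) (d : ℕ) (k : Fin (d + 1)) :
    Continuous (embeddedColumn b d k) := by
  change Continuous fun A : Matrix (Fin (d + 1)) (Fin (d + 1)) ℂ => ∑ m : Fin (d + 1), A m k • b m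
  refine continuous_finsetSum _ fun m _ => Continuous.smul ?_ continuous_const
  exact continuous_id.matrix_elem m k

lemma spinEmbedding_toEuclideanCLM_single (b : HilbertBasis ℕ ℂ H) (d : ℕ)
    (A : Matrix (Fin (d + 1)) (Fin (d + 1)) ℂ) (k : Fin (d + 1)) :
    spinEmbedding b d (Matrix.toEuclideanCLM (𝕜 := ℂ) A (EuclideanSpace.single k 1)) =
      embeddedColumn b d k A := by
  simp only [embeddedColumn, LinearMap.coe_mk, AddHom.coe_mk, spinEmbedding,
    sum_apply, InnerProductSpace.rankOne_apply,
    EuclideanSpace.inner_single_left]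
  refine Finset.sum_congr rfl fun m _ => ?_
  congr 1
  rw [EuclideanSpace.single, Matrix.toEuclideanCLM_toLp]
  simp

lemma hasSum_matrix_exp {m : Type*} [Fintype m] [DecidableEq m] (A : Matrix m m ℂ) :
    HasSum (fun N : ℕ => ((N.factorial : ℂ)⁻¹) • A ^ N) (NormedSpace.exp A) := by
  -- This norm serves only to sum the series; the conclusion involves just the topology.
  letI : NormedRing (Matrix m m ℂ) := Matrix.linftyOpNormedRing
  letI : NormedAlgebra ℂ (Matrix m m ℂ) := Matrix.linftyOpNormedAlgebra
  exact NormedSpace.exp_series_hasSum_exp' A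

lemma embeddedColumn_spinExp (b : HilbertBasis ℕ ℂ H) (n d : ℕ) (u : ℝ × ℝ) (k : Fin (d + 1)) :
    embeddedColumn b d k (spinExp d (localParam n u).1 (localParam n u).2 0) =
      ∑' N, weightedTerm b (alpha u) (spinWeight n d) k N := by
  have h := (hasSum_matrix_exp (spinGenerator n d u)).map (embeddedColumn b d k)
    (continuous_embeddedColumn b d k)
  refine h.tsum_eq.symm.trans (tsum_congr fun N => ?_)
  rw [Function.comp_apply, map_smul, weightedTerm, weightedExponent_pow_single, map_sum]
  congr 1
  simp [embeddedColumn, fockVector]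

lemma conjTranspose_spinExp_mul_self (n d : ℕ) (u : ℝ × ℝ) :
    (spinExp d (localParam n u).1 (localParam n u).2 0)ᴴ *
      spinExp d (localParam n u).1 (localParam n u).2 0 = 1 := by
  -- Definitional, since `spinGenerator` keeps the vanishing `J_z` term of `spinExp`.
  change (NormedSpace.exp (spinGenerator n d u))ᴴ * NormedSpace.exp (spinGenerator n d u) = 1
  rw [← Matrix.exp_conjTranspose, conjTranspose_spinGenerator, Matrix.exp_neg]
  exact Matrix.nonsing_inv_mul _ ((Matrix.isUnit_iff_isUnit_det _).1 (Matrix.isUnit_exp _))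

lemma norm_embeddedColumn_spinExp (b : HilbertBasis ℕ ℂ H) (n d : ℕ) (u : ℝ × ℝ)
    (k : Fin (d + 1)) :
    ‖embeddedColumn b d k (spinExp d (localParam n u).1 (localParam n u).2 0)‖ = 1 := by
  set U := spinExp d (localParam n u).1 (localParam n u).2 0 with hU
  have horth : Orthonormal ℂ fun m : Fin (d + 1) => b (m : ℕ) :=
    b.orthonormal.comp _ Fin.val_injective
  have h1 : inner ℂ (embeddedColumn b d k U) (embeddedColumn b d k U) = (1 : ℂ) := by
    have h := horth.inner_sum (fun m => U m k) (fun m => U m k) Finset.univ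
    have h2 := congrFun (congrFun (conjTranspose_spinExp_mul_self n d u) k) k
    rw [Matrix.mul_apply, Matrix.one_apply_eq] at h2
    exact h.trans h2
  rw [norm_eq_sqrt_re_inner (𝕜 := ℂ), h1]
  simp

end

end QubitLAN

namespace QubitLAN

/-! ### Spectral decompositions of the two states -/

noncomputable section

variable {H : Type*} [NormedAddCommGroup H] [InnerProductSpace ℂ H]

lemma thermalRatio_nonneg {μ : ℝ} (hμ : 1 / 2 < μ) (hμ1 : μ ≤ 1) : 0 ≤ thermalRatio μ :=
  div_nonneg (by linarith) (by linarith)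

lemma thermalRatio_lt_one {μ : ℝ} (hμ : 1 / 2 < μ) : thermalRatio μ < 1 := by
  rw [thermalRatio, div_lt_one (by linarith)]; linarith

/-- The eigenvalues of the block state, extended by zero. -/
def blockEigenvalue (μ : ℝ) (d k : ℕ) : ℝ :=
  if k ≤ d then (1 - thermalRatio μ) / (1 - thermalRatio μ ^ (d + 1)) * thermalRatio μ ^ k else 0

/-- The eigenvectors of the embedded block state, extended by zero. -/
def blockEigenvector (b : HilbertBasis ℕ ℂ H) (n d : ℕ) (u : ℝ × ℝ) (k : ℕ) : H :=
  if k ≤ d then ∑' N, weightedTerm b (alpha u) (spinWeight n d) k N else 0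

lemma norm_blockEigenvector_le (b : HilbertBasis ℕ ℂ H) (n d : ℕ) (u : ℝ × ℝ) (k : ℕ) :
    ‖blockEigenvector b n d u k‖ ≤ 1 := by
  unfold blockEigenvector
  split_ifs with h
  · exact ((embeddedColumn_spinExp b n d u ⟨k, Nat.lt_succ_of_le h⟩) ▸
      norm_embeddedColumn_spinExp b n d u ⟨k, Nat.lt_succ_of_le h⟩).le
  · simp

lemma toEuclideanCLM_diagonal {m : Type*} [Fintype m] [DecidableEq m] (c : m → ℂ) :
    Matrix.toEuclideanCLM (𝕜 := ℂ) (Matrix.diagonal c) = ∑ k, c k •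
      InnerProductSpace.rankOne ℂ (EuclideanSpace.single k (1 : ℂ))
        (EuclideanSpace.single k (1 : ℂ)) := by
  ext v i
  rw [← WithLp.toLp_ofLp 2 v, Matrix.toEuclideanCLM_toLp]
  simp [Matrix.mulVec_diagonal, EuclideanSpace.inner_single_left, Pi.single_apply]

variable [CompleteSpace H]

lemma hasSum_embeddedBlockState (b : HilbertBasis ℕ ℂ H) (μ : ℝ) (n d : ℕ) (u : ℝ × ℝ) :
    HasSum (fun k => (blockEigenvalue μ d k : ℂ) •
      InnerProductSpace.rankOne ℂ (blockEigenvector b n d u k) (blockEigenvector b n d u k))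
      (embeddedBlockState b μ n d u) := by
  set U := spinExp d (localParam n u).1 (localParam n u).2 0 with hU
  have h : embeddedBlockState b μ n d u = ∑ k ∈ Finset.range (d + 1),
      (blockEigenvalue μ d k : ℂ) •
        InnerProductSpace.rankOne ℂ (blockEigenvector b n d u k) (blockEigenvector b n d u k) := by
    -- With `L = V_j U_j` the state is `L ρ⁰ L^*`, and `ρ⁰` is diagonal, so the eigenvectors are the
    -- images of the basis under `L`.
    set L : EuclideanSpace ℂ (Fin (d + 1)) →L[ℂ] H :=
      spinEmbedding b d ∘L Matrix.toEuclideanCLM (𝕜 := ℂ) U with hL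
    have h1 : embeddedBlockState b μ n d u = L ∘L
        Matrix.toEuclideanCLM (𝕜 := ℂ) (blockStateZero μ d) ∘L ContinuousLinearMap.adjoint L := by
      rw [embeddedBlockState, blockState, map_mul, map_mul, ← Matrix.star_eq_conjTranspose,
        map_star, hL, ContinuousLinearMap.adjoint_comp]
      rfl
    rw [h1, blockStateZero, toEuclideanCLM_diagonal, Finset.sum_range]
    simp only [ContinuousLinearMap.finsetSum_comp, ContinuousLinearMap.comp_finsetSum,
      ContinuousLinearMap.smul_comp, ContinuousLinearMap.comp_smul, comp_rankOne_comp_adjoint]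
    refine Finset.sum_congr rfl fun k _ => ?_
    have hk : (k : ℕ) ≤ d := Nat.lt_succ_iff.1 k.isLt
    have hLk : L (EuclideanSpace.single k 1) = blockEigenvector b n d u k := by
      rw [hL, ContinuousLinearMap.comp_apply, spinEmbedding_toEuclideanCLM_single,
        embeddedColumn_spinExp, blockEigenvector, if_pos hk]
    rw [hLk, blockEigenvalue, if_pos hk]
  rw [h]
  refine hasSum_sum_of_ne_finset_zero fun k hk => ?_
  have : ¬ k ≤ d := by simpa [Nat.lt_succ_iff] using hk
  simp [blockEigenvalue, this]

lemma displacement_eq_tsum_weightedTerm (b : HilbertBasis ℕ ℂ H) (z : ℂ) (c : ℝ) (k : ℕ) :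
    displacement b (c * z) (b k) = ∑' N, weightedTerm b z (fun _ => c) k N := by
  rw [displacement_basis, ← weightedExponent_const]
  rfl

lemma hasSum_displacedThermalState (b : HilbertBasis ℕ ℂ H) {μ : ℝ} (hμ : 1 / 2 < μ)
    (hμ1 : μ ≤ 1) (u : ℝ × ℝ) :
    HasSum (fun k => (((1 - thermalRatio μ) * thermalRatio μ ^ k : ℝ) : ℂ) •
      InnerProductSpace.rankOne ℂ
        (displacement b (((√(2 * μ - 1) : ℝ) : ℂ) * alpha u) (b k))
        (displacement b (((√(2 * μ - 1) : ℝ) : ℂ) * alpha u) (b k)))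
      (displacedThermalState b μ u) := by
  have hp0 := thermalRatio_nonneg hμ hμ1
  have hp1 := thermalRatio_lt_one hμ
  have hs : Summable fun k : ℕ => (((1 - thermalRatio μ) * thermalRatio μ ^ k : ℝ) : ℂ) •
      InnerProductSpace.rankOne ℂ (b k) (b k) := by
    refine Summable.of_norm_bounded
      ((summable_geometric_of_lt_one hp0 hp1).mul_left (1 - thermalRatio μ)) fun k => ?_
    rw [norm_smul, InnerProductSpace.norm_rankOne, b.orthonormal.1 k, Complex.norm_real,
      Real.norm_of_nonneg (mul_nonneg (by linarith) (pow_nonneg hp0 k))]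
    simp
  set D : H →L[ℂ] H :=
    (displacement b (((√(2 * μ - 1) : ℝ) : ℂ) * alpha u)).toContinuousLinearMap with hD
  have h := hs.hasSum.map (AddMonoidHom.mk'
    (fun A : H →L[ℂ] H => D ∘L A ∘L ContinuousLinearMap.adjoint D)
      (by intros; simp [ContinuousLinearMap.add_comp, ContinuousLinearMap.comp_add]))
    (by
      change Continuous fun A : H →L[ℂ] H => D ∘L A ∘L ContinuousLinearMap.adjoint D
      fun_prop)
  refine (h.congr_fun ?_)
  intro k
  change _ = D ∘L ((((1 - thermalRatio μ) * thermalRatio μ ^ k : ℝ) : ℂ) •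
      InnerProductSpace.rankOne ℂ (b k) (b k)) ∘L ContinuousLinearMap.adjoint D
  rw [ContinuousLinearMap.smul_comp, ContinuousLinearMap.comp_smul, comp_rankOne_comp_adjoint]
  rfl

/-! ### Uniform convergence over the typical spins -/

/-- The filter of triples `(n, d, u)` with `n → ∞`, `d ∈ typicalSpins μ ε n` and `u ∈ K`. -/
def typicalFilter (μ ε : ℝ) (K : Set (ℝ × ℝ)) : Filter (ℕ × ℕ × (ℝ × ℝ)) :=
  comap Prod.fst atTop ⊓ 𝓟 {x | x.2.1 ∈ typicalSpins μ ε x.1 ∧ x.2.2 ∈ K}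

lemma tendsto_fst_typicalFilter (μ ε : ℝ) (K : Set (ℝ × ℝ)) :
    Tendsto Prod.fst (typicalFilter μ ε K) atTop :=
  tendsto_comap.mono_left inf_le_left

lemma eventually_mem_typicalFilter (μ ε : ℝ) (K : Set (ℝ × ℝ)) :
    ∀ᶠ x in typicalFilter μ ε K, x.2.1 ∈ typicalSpins μ ε x.1 ∧ x.2.2 ∈ K :=
  mem_inf_of_right (mem_principal_self _)

lemma le_of_mem_typicalSpins {μ ε : ℝ} {n d : ℕ} (h : d ∈ typicalSpins μ ε n) : d ≤ n := by
  obtain ⟨⟨r, hr⟩, -⟩ := h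
  omega

/-- Dividing the window by `n` bounds the deviation by `2 n^(-(1/2-ε))`, which tends to zero because
`ε < 1/2`. -/
lemma tendsto_spin_ratio {μ ε : ℝ} (hε1 : ε < 1 / 2) (K : Set (ℝ × ℝ)) :
    Tendsto (fun x : ℕ × ℕ × (ℝ × ℝ) => (x.2.1 : ℝ) / x.1) (typicalFilter μ ε K)
      (𝓝 (2 * μ - 1)) := by
  have hn : Tendsto (fun x : ℕ × ℕ × (ℝ × ℝ) => (x.1 : ℝ)) (typicalFilter μ ε K) atTop :=
    tendsto_natCast_atTop_atTop.comp (tendsto_fst_typicalFilter μ ε K)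
  have h0 : Tendsto (fun x : ℕ × ℕ × (ℝ × ℝ) => 2 * (x.1 : ℝ) ^ (-(1 / 2 - ε)))
      (typicalFilter μ ε K) (𝓝 0) := by
    have := ((tendsto_rpow_neg_atTop (show 0 < 1 / 2 - ε by linarith)).comp hn).const_mul 2
    simpa using this
  rw [tendsto_iff_norm_sub_tendsto_zero]
  refine squeeze_zero' (Eventually.of_forall fun _ => norm_nonneg _) ?_ h0
  filter_upwards [eventually_mem_typicalFilter μ ε K, hn.eventually_gt_atTop 0] with x hx hpos
  have hb := hx.1.2
  have e1 : (x.2.1 : ℝ) / x.1 - (2 * μ - 1) =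
      2 * ((x.2.1 : ℝ) / 2 - x.1 * (μ - 1 / 2)) / x.1 := by
    field_simp
  have e2 : (x.1 : ℝ) ^ (-(1 / 2 - ε)) = (x.1 : ℝ) ^ (1 / 2 + ε) / x.1 := by
    rw [show -(1 / 2 - ε) = (1 / 2 + ε) - 1 by ring, Real.rpow_sub_one hpos.ne']
  rw [e1, e2, Real.norm_eq_abs, abs_div, abs_mul, abs_of_pos hpos, abs_two, ← mul_div_assoc]
  gcongr

lemma tendsto_spinWeight {μ ε : ℝ} (hε1 : ε < 1 / 2) (K : Set (ℝ × ℝ)) (k : ℕ) :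
    Tendsto (fun x : ℕ × ℕ × (ℝ × ℝ) => spinWeight x.1 x.2.1 k) (typicalFilter μ ε K)
      (𝓝 (√(2 * μ - 1))) := by
  have hn : Tendsto (fun x : ℕ × ℕ × (ℝ × ℝ) => (x.1 : ℝ)) (typicalFilter μ ε K) atTop :=
    tendsto_natCast_atTop_atTop.comp (tendsto_fst_typicalFilter μ ε K)
  have h := (tendsto_spin_ratio hε1 K (μ := μ)).sub (hn.const_div_atTop (k : ℝ))
  rw [sub_zero] at h
  refine ((Real.continuous_sqrt.tendsto _).comp h).congr fun x => ?_
  rw [Function.comp_apply, spinWeight, sub_div]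

/-- Here `d = (d/n) n`, and the ratio has the positive limit `2μ - 1`. -/
lemma tendsto_typical_spin {μ ε : ℝ} (hμ : 1 / 2 < μ) (hε1 : ε < 1 / 2) (K : Set (ℝ × ℝ)) :
    Tendsto (fun x : ℕ × ℕ × (ℝ × ℝ) => x.2.1) (typicalFilter μ ε K) atTop := by
  have hn : Tendsto (fun x : ℕ × ℕ × (ℝ × ℝ) => (x.1 : ℝ)) (typicalFilter μ ε K) atTop :=
    tendsto_natCast_atTop_atTop.comp (tendsto_fst_typicalFilter μ ε K)
  rw [← tendsto_natCast_atTop_iff (R := ℝ)]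
  refine ((tendsto_spin_ratio hε1 K (μ := μ)).pos_mul_atTop (by linarith) hn).congr' ?_
  filter_upwards [hn.eventually_gt_atTop 0] with x hx
  exact div_mul_cancel₀ _ hx.ne'

/-! ### Limits of the eigenvalues and eigenvectors, and dominated convergence -/

lemma tendsto_blockEigenvalue {μ : ℝ} (hμ : 1 / 2 < μ) (hμ1 : μ ≤ 1) (k : ℕ) :
    Tendsto (fun d => blockEigenvalue μ d k) atTop
      (𝓝 ((1 - thermalRatio μ) * thermalRatio μ ^ k)) := by
  have h := (tendsto_pow_atTop_nhds_zero_of_lt_one (thermalRatio_nonneg hμ hμ1)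
    (thermalRatio_lt_one hμ)).comp (tendsto_add_atTop_nat 1)
  have h2 := ((h.const_sub 1).inv₀ (by norm_num)).const_mul (1 - thermalRatio μ)
  have h3 := h2.mul_const (thermalRatio μ ^ k)
  rw [sub_zero, inv_one, mul_one] at h3
  refine h3.congr' ?_
  filter_upwards [eventually_ge_atTop k] with d hd
  rw [blockEigenvalue, if_pos hd, div_eq_mul_inv]
  rfl

/-- The normalizing factor is at most one because `p^(d+1) ≤ p`. The bound is free of `d`, as
domination requires. -/
lemma abs_blockEigenvalue_le {μ : ℝ} (hμ : 1 / 2 < μ) (hμ1 : μ ≤ 1) (d k : ℕ) :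
    |blockEigenvalue μ d k| ≤ thermalRatio μ ^ k := by
  have hp0 := thermalRatio_nonneg hμ hμ1
  have hp1 := thermalRatio_lt_one hμ
  unfold blockEigenvalue
  split_ifs
  · have hle : thermalRatio μ ^ (d + 1) ≤ thermalRatio μ :=
      pow_le_of_le_one hp0 hp1.le (Nat.succ_ne_zero d)
    have hc : (1 - thermalRatio μ) / (1 - thermalRatio μ ^ (d + 1)) ≤ 1 :=
      (div_le_one (by linarith)).2 (by linarith)
    have hc0 : 0 ≤ (1 - thermalRatio μ) / (1 - thermalRatio μ ^ (d + 1)) :=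
      div_nonneg (by linarith) (by linarith)
    rw [abs_of_nonneg (mul_nonneg hc0 (pow_nonneg hp0 k))]
    exact mul_le_of_le_one_left (pow_nonneg hp0 k) hc
  · simpa using pow_nonneg hp0 k

lemma norm_alpha_le (u : ℝ × ℝ) : ‖alpha u‖ ≤ 2 * ‖u‖ := by
  have h1 : |u.1| ≤ ‖u‖ := norm_fst_le u
  have h2 : |u.2| ≤ ‖u‖ := norm_snd_le u
  refine (norm_add_le _ _).trans ?_
  rw [norm_neg, norm_mul, Complex.norm_I, one_mul, Complex.norm_real, Complex.norm_real,
    Real.norm_eq_abs, Real.norm_eq_abs]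
  linarith

lemma tendsto_blockEigenvector_sub (b : HilbertBasis ℕ ℂ H) {μ ε : ℝ} (hμ : 1 / 2 < μ)
    (hμ1 : μ ≤ 1) (hε1 : ε < 1 / 2) {K : Set (ℝ × ℝ)} (hK : Bornology.IsBounded K) (k : ℕ) :
    Tendsto (fun x : ℕ × ℕ × (ℝ × ℝ) => blockEigenvector b x.1 x.2.1 x.2.2 k -
      displacement b (((√(2 * μ - 1) : ℝ) : ℂ) * alpha x.2.2) (b k)) (typicalFilter μ ε K)
      (𝓝 0) := by
  obtain ⟨R, hR⟩ := hK.exists_norm_le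
  have hmem := eventually_mem_typicalFilter μ ε K
  have hsq : |√(2 * μ - 1)| ≤ 1 := by
    rw [abs_of_nonneg (Real.sqrt_nonneg _), Real.sqrt_le_iff]
    refine ⟨zero_le_one, ?_⟩
    linarith
  have h := tendsto_tsum_weightedTerm_sub b (l := typicalFilter μ ε K)
    (z := fun x => alpha x.2.2) (w := fun x => spinWeight x.1 x.2.1)
    (w' := fun _ => √(2 * μ - 1)) (R := 2 * R)
    (hmem.mono fun x hx => (norm_alpha_le _).trans (by linarith [hR _ hx.2]))
    (hmem.mono fun x hx => abs_spinWeight_le_one (le_of_mem_typicalSpins hx.1))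
    (fun _ => hsq) (tendsto_spinWeight hε1 K) k
  refine h.congr' ?_
  -- Once `d ≥ k`, the extension by zero is not seen at level `k`.
  filter_upwards [(tendsto_typical_spin hμ hε1 K).eventually_ge_atTop k] with x hx
  rw [displacement_eq_tsum_weightedTerm, blockEigenvector, if_pos hx]

lemma tendsto_traceNorm_typicalFilter (b : HilbertBasis ℕ ℂ H) {μ ε : ℝ} (hμ : 1 / 2 < μ)
    (hμ1 : μ ≤ 1) (hε1 : ε < 1 / 2) {K : Set (ℝ × ℝ)} (hK : Bornology.IsBounded K) :
    Tendsto (fun x : ℕ × ℕ × (ℝ × ℝ) => traceNorm b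
      (embeddedBlockState b μ x.1 x.2.1 x.2.2 - displacedThermalState b μ x.2.2))
      (typicalFilter μ ε K) (𝓝 0) := by
  have hp0 := thermalRatio_nonneg hμ hμ1
  have hp1 := thermalRatio_lt_one hμ
  set s : ℕ → ℝ := fun k => (1 - thermalRatio μ) * thermalRatio μ ^ k with hs
  have hs0 : ∀ k, 0 ≤ s k := fun k => mul_nonneg (by linarith) (pow_nonneg hp0 k)
  have hsp : ∀ k, s k ≤ thermalRatio μ ^ k := fun k =>
    mul_le_of_le_one_left (pow_nonneg hp0 k) (by linarith)
  set y : ℝ × ℝ → ℕ → H := fun u k =>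
    displacement b (((√(2 * μ - 1) : ℝ) : ℂ) * alpha u) (b k) with hy
  have hy1 : ∀ u k, ‖y u k‖ ≤ 1 := fun u k => by
    rw [hy]; simp only [LinearIsometry.norm_map, b.orthonormal.1 k, le_refl]
  set f : ℕ × ℕ × (ℝ × ℝ) → ℕ → ℝ := fun x k => |blockEigenvalue μ x.2.1 k - s k| +
    2 * s k * ‖blockEigenvector b x.1 x.2.1 x.2.2 k - y x.2.2 k‖ with hf
  -- `6 = 2 + 4`: the eigenvalue difference is at most `2 p^k`, and the vector term at most `2 · p^k
  -- · 2`.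
  have hsumm : Summable fun k => 6 * thermalRatio μ ^ k :=
    (summable_geometric_of_lt_one hp0 hp1).mul_left 6
  have hf0 : ∀ x k, 0 ≤ f x k := fun x k =>
    add_nonneg (abs_nonneg _) (mul_nonneg (mul_nonneg two_pos.le (hs0 k)) (norm_nonneg _))
  have hfb : ∀ x k, ‖f x k‖ ≤ 6 * thermalRatio μ ^ k := by
    intro x k
    rw [Real.norm_of_nonneg (hf0 x k)]
    have h1 : |blockEigenvalue μ x.2.1 k - s k| ≤ 2 * thermalRatio μ ^ k := by
      refine (abs_sub _ _).trans ?_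
      rw [abs_of_nonneg (hs0 k)]
      linarith [abs_blockEigenvalue_le hμ hμ1 x.2.1 k, hsp k]
    have h2 : ‖blockEigenvector b x.1 x.2.1 x.2.2 k - y x.2.2 k‖ ≤ 2 := by
      have hv := norm_blockEigenvector_le b x.1 x.2.1 x.2.2 k
      have hw := hy1 x.2.2 k
      exact (norm_sub_le _ _).trans (by linarith)
    have h3 : 2 * s k * ‖blockEigenvector b x.1 x.2.1 x.2.2 k - y x.2.2 k‖ ≤
        2 * thermalRatio μ ^ k * 2 := by
      gcongr
      exact hsp k
    change |blockEigenvalue μ x.2.1 k - s k| + _ ≤ _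
    linarith
  have hlim : Tendsto (fun x => ∑' k, f x k) (typicalFilter μ ε K) (𝓝 0) := by
    have h := tendsto_tsum_of_dominated_convergence (𝓕 := typicalFilter μ ε K) (f := f)
      (g := fun _ => (0 : ℝ)) hsumm (fun k => ?_) (Eventually.of_forall fun x k => hfb x k)
    · rwa [tsum_zero] at h
    · have h1 := (((tendsto_blockEigenvalue hμ hμ1 k).comp
        (tendsto_typical_spin hμ hε1 K)).sub_const (s k)).abs
      have h2 := ((tendsto_blockEigenvector_sub b hμ hμ1 hε1 hK k).norm).const_mul (2 * s k)
      have h3 := h1.add h2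
      simpa [hs] using h3
  have hlim' : Tendsto (fun x => ENNReal.ofReal (∑' k, f x k)) (typicalFilter μ ε K) (𝓝 0) := by
    simpa using ENNReal.tendsto_ofReal hlim
  refine tendsto_of_tendsto_of_tendsto_of_le_of_le tendsto_const_nhds hlim'
    (fun _ => zero_le) fun x => ?_
  exact traceNorm_le_of_hasSum_rankOne b (norm_blockEigenvector_le b x.1 x.2.1 x.2.2)
    (hy1 x.2.2) hs0
    ((hasSum_embeddedBlockState b μ x.1 x.2.1 x.2.2).sub
      (hasSum_displacedThermalState b hμ hμ1 x.2.2))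
    (Summable.of_norm_bounded hsumm (hfb x))

end

end QubitLAN

theorem mainTheorem2 {H : Type*} [NormedAddCommGroup H] [InnerProductSpace ℂ H] [CompleteSpace H]
    (b : HilbertBasis ℕ ℂ H) (μ : ℝ) (hμ : 1 / 2 < μ) (hμ1 : μ ≤ 1)
    (ε : ℝ) (hε : 0 < ε) (hε1 : ε < 1 / 2) (I : Set ℝ) (hI : Bornology.IsBounded I) :
    Tendsto
      (fun n : ℕ => ⨆ u ∈ I ×ˢ I, ⨆ d ∈ QubitLAN.typicalSpins μ ε n,
        QubitLAN.traceNorm b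
          (QubitLAN.embeddedBlockState b μ n d u - QubitLAN.displacedThermalState b μ u))
      atTop (𝓝 0) := by
  have h := QubitLAN.tendsto_traceNorm_typicalFilter b hμ hμ1 hε1 (hI.prod hI)
  rw [ENNReal.tendsto_nhds_zero] at h ⊢
  intro δ hδ
  have h1 := h δ hδ
  -- Unfolding the filter gives a bound valid for all large `n` and simultaneously for every
  -- admissible `(d, u)`, which is what bounds the nested suprema.
  rw [QubitLAN.typicalFilter, eventually_inf_principal, eventually_comap] at h1
  filter_upwards [h1] with n hn
  exact iSup₂_le fun u hu => iSup₂_le fun d hd => hn (n, d, u) rfl ⟨hd, hu⟩
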